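/- **Setting.** Fix $d\ge 2$. Let $\mathcal A$ be the quasi-local $C^*$-algebra of the quantum spin system on $\mathbb Z^2$ with one-site algebra $M_d(\mathbb C)$; for $X\subset\mathbb R^2$ let $\mathcal A_X\subset\mathcal A$ be the $C^*$-subalgebra generated by the sites in $X\cap\mathbb Z^2$. Let $G$ be a finite group and $U$ a unitary representation of $G$ on $\mathbb C^d$ such that $g\mapsto \mathrm{Ad}\,U_g\in\mathrm{Aut}\,M_d$ is injective. For $X\subset\mathbb R^2$ let $\beta_g^X\in\mathrm{Aut}\,\mathcal A$ act as $\mathrm{Ad}\,U_g$ on each site in $X$ and trivially on the other sites. Let $\omega$ be a pure state on $\mathcal A$ with $\omega\circ\beta_g^{\mathbb R^2}=\omega$ for all $g$, and let $(\mathcal H,\pi,\Omega)$ be a GNS triple of $\omega$. For $a\in\mathbb R^2$, $\theta\in\mathbb R$, $0<\varphi<\pi$ put $e_\theta=(\cos\theta,\sin\theta)$ and let $\Lambda_{a,\theta,\varphi}=\{x:(x-a)\cdot e_\theta>\cos\varphi\,\|x-a\|\}$ (an open cone), with $\arg\Lambda=\{e^{it}: |t-\theta|\le\varphi\}$ and half-angle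 $\varphi$; for $0<\varepsilon<\min\{\varphi,\pi-\varphi\}$ put $(\partial\Lambda)_\varepsilon=\Lambda_{a,\theta+\varphi,\varepsilon}\cup\Lambda_{a,\theta-\varphi,\varepsilon}$. Right cones are the $\Lambda_{(s,0),0,\varphi}$; left cones are their complements $\overline{\Lambda_{(s,0),\pi,\varphi}}$, with $\arg$, half-angle and $(\partial\Lambda)_\varepsilon$ those of $\Lambda_{(s,0),\pi,\varphi}$. "Cone" means an open cone or a left cone. $PC$ is the set of pairs $(\Lambda_1,\Lambda_2)$ of a left cone and a right cone with $\Lambda_1\cap\Lambda_2=\emptyset$ such that, for some $\varepsilon>0$, the arc $\arg\Lambda_1$ enlarged by the angle $\varepsilon$ at both ends is disjoint from $\arg\Lambda_2$. Let $$\mathcal F=\overline{\bigcup_{(\Lambda_1,\Lambda_2)\in PC}\pi(\mathcal A_{(\Lambda_1\cup\Lambda_2)^c})''}^{\,\|\cdot\|},\qquad \mathcal B=\overline{\bigcup_{\Lambda}\pi(\mathcal A_\Lambda)''}^{\,\|\cdot\|},$$ where in the second union $\Lambda$ runs over the open cones with $\arg\Lambda\cap\{e^{it}:|t|\le\varphi_0\}=\emptyset$,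 for a fixed $\varphi_0\in(0,\pi/2)$. Fix $(\Lambda_1^{(0)},\Lambda_2^{(0)})\in PC$. A representation $\rho$ of $\mathcal A$ on $\mathcal H$ is in $O$ if for every cone $\Lambda$ there is a unitary $V$ on $\mathcal H$ with $V\rho(A)V^*=\pi(A)$ for all $A\in\mathcal A_{\Lambda^c}$. For $g\in G$, $O^{(g)}$ is the set of $\rho\in O$ such that for every $(\Lambda_1,\Lambda_2)\in PC$ there is a unitary $V\in\mathcal F$ with $V\rho(A)V^*=\pi\beta_g^{\Lambda_1}(A)$ for all $A\in\mathcal A_{\Lambda_1\cup\Lambda_2}$; and $O^{(g)}_{(\Lambda_1^{(0)},\Lambda_2^{(0)})}$ is the set of $\rho\in O^{(g)}$ for which $V=\mathbb I$ has this property for $(\Lambda_1^{(0)},\Lambda_2^{(0)})$. The tensor product is $\rho\otimes\sigma:=T_\rho T_\sigma\pi$, where $T_\rho:\mathcal B\to B(\mathcal H)$ is the $*$-homomorphism with $T_\rho\pi=\rho$ that is $\sigma$-weakly continuous on $\pi(\mathcal A_\Lambda)''$ for each $\Lambda$ occurring in the definition of $\mathcal B$. Let $H$ be the set of all $g\in G$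 for which there are an irreducible $\sigma_g\in O^{(g)}_{(\Lambda_1^{(0)},\Lambda_2^{(0)})}$ and some $\sigma_g^{-1}\in O^{(g^{-1})}_{(\Lambda_1^{(0)},\Lambda_2^{(0)})}$ with $\sigma_g^{-1}\otimes\sigma_g=\pi$. **Local boundary excitation.** Assume that there are, for all $g\in G$, all cones $\Lambda$ and all $0<\varepsilon<\frac12\min\{|\arg\Lambda|,2\pi-|\arg\Lambda|\}$ (with $|\arg\Lambda|$ twice the half-angle), automorphisms $\gamma_{g,\Lambda}\in\mathrm{Aut}\,\mathcal A$ and $\gamma_{g,\Lambda,\varepsilon}\in\mathrm{Aut}\,\mathcal A_{(\partial\Lambda)_\varepsilon}$ (extended to $\mathcal A$ by the identity on $\mathcal A_{((\partial\Lambda)_\varepsilon)^c}$) and unitaries $u_{g,\Lambda,\varepsilon}\in\mathcal A$ such that $\omega\beta_g^\Lambda=\omega\gamma_{g,\Lambda}$ and $\gamma_{g,\Lambda}=\mathrm{Ad}(u_{g,\Lambda,\varepsilon})\gamma_{g,\Lambda,\varepsilon}$, and such that the unitaries $v_{g,\Lambda}$ on $\mathcal H$ given by $v_{g,\Lambda}\pi(A)\Omega=\pi(\beta_g^\Lambda\gamma_{g,\Lambda}^{-1}(A))\Omega$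 satisfy $v_{g,\Lambda}\mathcal F v_{g,\Lambda'}^*\subset\mathcal F$ and $v_{g,\Lambda}^*\mathcal F v_{g,\Lambda'}\subset\mathcal F$ for all left cones $\Lambda,\Lambda'$ and all $g$. **Lemma.** Let $\Lambda$ be a left cone and $0<\varepsilon<\frac12\min\{|\arg\Lambda|,2\pi-|\arg\Lambda|\}$ such that $(\partial\Lambda)_\varepsilon\subset(\Lambda_1^{(0)}\cup\Lambda_2^{(0)})^c$ and $\Lambda_1^{(0)}\subset\Lambda\subset(\Lambda_2^{(0)})^c$. Then for all $g\in G$ $$\sigma_g:=\pi\beta_g^\Lambda\gamma_{g,\Lambda,\varepsilon}^{-1}\in O^{(g)}_{(\Lambda_1^{(0)},\Lambda_2^{(0)})},\qquad \sigma_g^{-1}:=\pi\gamma_{g,\Lambda,\varepsilon}(\beta_g^\Lambda)^{-1}\in O^{(g^{-1})}_{(\Lambda_1^{(0)},\Lambda_2^{(0)})},$$ $\sigma_g$ is irreducible, and $\sigma_g^{-1}\otimes\sigma_g$ is defined and equals $\pi$. Consequently $H=G$. -/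

import Mathlib

open Filter Topology

noncomputable section

namespace SET

/-! ## The quasi-local algebra of the quantum spin system -/

/-- Sites of the lattice `ℤ²`. -/
abbrev Site : Type := ℤ × ℤ

/-- Classical spin configurations. -/
abbrev Config (d : ℕ) : Type := Site → Fin d

/-- `ℓ²` of the configurations, on which the local matrix algebras act faithfully. -/
abbrev ConfigSpace (d : ℕ) : Type := lp (fun _ : Config d => ℂ) 2

/-- One-site matrices. -/
abbrev Mat (d : ℕ) : Type := Matrix (Fin d) (Fin d) ℂ

theorem update_swap {d : ℕ} (z : Site) (i j : Fin d) (x : Config d) (hx : x z = i) :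
    Function.update x z j = Function.update x z (Equiv.swap i j (x z)) := by
  simp [hx]

/-- The involution of the configurations that exchanges the values `i` and `j` at `z`. -/
def siteFlip {d : ℕ} (z : Site) (i j : Fin d) : Equiv.Perm (Config d) :=
  Function.Involutive.toPerm (fun x => Function.update x z (Equiv.swap i j (x z))) (by
    intro x
    simp)

theorem siteFlip_apply {d : ℕ} (z : Site) (i j : Fin d) (x : Config d) :
    siteFlip z i j x = Function.update x z (Equiv.swap i j (x z)) := rfl

/-- The action of the matrix unit `e_{ij}` at `z` on functions of configurations. -/
def unitFun {d : ℕ} (z : Site) (i j : Fin d) (f : Config d → ℂ) : Config d → ℂ :=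
  fun x => if x z = i then f (Function.update x z j) else 0

theorem unitFun_siteFlip {d : ℕ} (z : Site) (i j : Fin d) (f : Config d → ℂ) (x : Config d) :
    unitFun z i j f x = if x z = i then f (siteFlip z i j x) else 0 := by
  unfold unitFun
  split_ifs with h
  · rw [update_swap z i j x h]; rfl
  · rfl

theorem norm_unitFun_le {d : ℕ} (z : Site) (i j : Fin d) (f : Config d → ℂ) (x : Config d) :
    ‖unitFun z i j f x‖ ^ 2 ≤ ‖f (siteFlip z i j x)‖ ^ 2 := by
  rw [unitFun_siteFlip]
  split_ifs with h
  · exact le_rfl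
  · simp

theorem summable_sq {d : ℕ} (f : ConfigSpace d) : Summable fun x => ‖f x‖ ^ 2 := by
  have := (lp.memℓp f).summable (by norm_num)
  simpa using this

theorem norm_sq_eq {d : ℕ} (f : ConfigSpace d) : ‖f‖ ^ 2 = ∑' x, ‖f x‖ ^ 2 := by
  have := lp.norm_rpow_eq_tsum (p := 2) (by norm_num) f
  simpa using this

theorem unitFun_mem {d : ℕ} (z : Site) (i j : Fin d) (f : ConfigSpace d) :
    Memℓp (E := fun _ : Config d => ℂ) (unitFun z i j f) 2 := by
  apply memℓp_gen
  have h := ((siteFlip z i j).summable_iff).2 (summable_sq f)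
  have := Summable.of_nonneg_of_le (fun x => by positivity) (norm_unitFun_le z i j f) h
  simpa using this

/-- The matrix unit `e_{ij}` at the site `z` as a bounded operator. -/
def siteUnit {d : ℕ} (z : Site) (i j : Fin d) : ConfigSpace d →L[ℂ] ConfigSpace d :=
  LinearMap.mkContinuous
    { toFun := fun f => (⟨unitFun z i j f, unitFun_mem z i j f⟩ : ConfigSpace d)
      map_add' := by
        intro f g
        ext x
        show unitFun z i j (f + g) x = unitFun z i j f x + unitFun z i j g x
        unfold unitFun
        split_ifs <;> simp
      map_smul' := by
        intro c f
        ext x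
        show unitFun z i j (c • f) x = c • unitFun z i j f x
        unfold unitFun
        split_ifs <;> simp } 1 (by
    intro f
    rw [one_mul]
    refine le_of_sq_le_sq ?_ (norm_nonneg _)
    rw [norm_sq_eq, norm_sq_eq, ← (siteFlip z i j).tsum_eq (fun x => ‖f x‖ ^ 2)]
    refine Summable.tsum_le_tsum (norm_unitFun_le z i j f) ?_
      (((siteFlip z i j).summable_iff).2 (summable_sq f))
    exact summable_sq (⟨unitFun z i j f, unitFun_mem z i j f⟩ : ConfigSpace d))

theorem siteUnit_apply {d : ℕ} (z : Site) (i j : Fin d) (f : ConfigSpace d) (x : Config d) :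
    siteUnit z i j f x = if x z = i then f (Function.update x z j) else 0 := rfl

theorem star_siteUnit {d : ℕ} (z : Site) (i j : Fin d) :
    star (siteUnit (d := d) z i j) = siteUnit z j i := by
  rw [ContinuousLinearMap.star_eq_adjoint]
  symm
  rw [ContinuousLinearMap.eq_adjoint_iff]
  intro f g
  rw [lp.inner_eq_tsum, lp.inner_eq_tsum, ← (siteFlip z i j).tsum_eq]
  refine tsum_congr fun x => ?_
  rw [siteUnit_apply, siteUnit_apply]
  have hz : (siteFlip z i j x) z = Equiv.swap i j (x z) := by simp [siteFlip_apply]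
  rw [hz]
  by_cases h : x z = i
  · have h1 : Function.update (siteFlip z i j x) z i = x := by
      simp [siteFlip_apply, ← h]
    have h2 : siteFlip z i j x = Function.update x z j := by
      simp [siteFlip_apply, h]
    rw [h1, if_pos (by simp [h]), if_pos h, h2]
  · have : Equiv.swap i j (x z) ≠ j := by
      intro h'
      apply h
      have := congrArg (Equiv.swap i j) h'
      simpa using this
    simp [h, this]

/-- The one-site matrix `a`, placed at the site `z` (and tensored with identities elsewhere):
`(a ψ)(x) = ∑ j, a (x z) j * ψ (x with the value at z replaced by j)`. -/
def siteOp {d : ℕ} (z : Site) (a : Mat d) : ConfigSpace d →L[ℂ] ConfigSpace d :=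
  ∑ i, ∑ j, a i j • siteUnit z i j

theorem siteOp_apply {d : ℕ} (z : Site) (a : Mat d) (f : ConfigSpace d) (x : Config d) :
    siteOp z a f x = ∑ j, a (x z) j * f (Function.update x z j) := by
  have : siteOp z a f x = ∑ i, ∑ j, a i j * (siteUnit z i j f x) := by
    simp only [siteOp, sum_apply, smul_apply,
      lp.coeFn_sum, Finset.sum_apply, lp.coeFn_smul, Pi.smul_apply, smul_eq_mul]
  rw [this, Finset.sum_eq_single (x z)]
  · simp [siteUnit_apply]
  · intro i _ hi
    simp [siteUnit_apply, hi.symm]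
  · simp

/-- `siteOp z` as a unital `*`-homomorphism from the one-site matrices. -/
def siteHom (d : ℕ) (z : Site) : Mat d →⋆ₐ[ℂ] (ConfigSpace d →L[ℂ] ConfigSpace d) :=
  { AlgHom.ofLinearMap
      { toFun := siteOp z
        map_add' := fun a b => by simp [siteOp, add_smul, Finset.sum_add_distrib]
        map_smul' := fun c a => by simp [siteOp, mul_smul, Finset.smul_sum] }
      (by
        ext f x
        show siteOp z 1 f x = f x
        rw [siteOp_apply]
        simp [Matrix.one_apply])
      (by
        intro a b
        ext f x
        show siteOp z (a * b) f x = siteOp z a (siteOp z b f) x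
        rw [siteOp_apply, siteOp_apply]
        simp only [siteOp_apply, Matrix.mul_apply, Finset.sum_mul, Finset.mul_sum,
          Function.update_self, Function.update_idem]
        rw [Finset.sum_comm]
        simp only [mul_assoc]) with
    map_star' := fun a => by
      show siteOp z (star a) = star (siteOp z a)
      simp only [siteOp, star_sum, star_smul, star_siteUnit]
      rw [Finset.sum_comm]
      rfl }

theorem siteHom_apply {d : ℕ} (z : Site) (a : Mat d) (f : ConfigSpace d) (x : Config d) :
    siteHom d z a f x = ∑ j, a (x z) j * f (Function.update x z j) := siteOp_apply z a f x

/-- Matrices at different sites commute. -/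
theorem siteHom_commute {d : ℕ} {z w : Site} (h : z ≠ w) (a b : Mat d) :
    Commute (siteHom d z a) (siteHom d w b) := by
  show siteHom d z a * siteHom d w b = siteHom d w b * siteHom d z a
  ext f x
  show siteHom d z a (siteHom d w b f) x = siteHom d w b (siteHom d z a f) x
  simp only [siteHom_apply, Finset.mul_sum, Function.update_of_ne h, Function.update_of_ne h.symm]
  rw [Finset.sum_comm]
  refine Finset.sum_congr rfl fun i _ => Finset.sum_congr rfl fun j _ => ?_
  rw [Function.update_comm h]
  ring

/-- The C*-algebra `𝒜` of the two-dimensional quantum spin system with one-site algebra `M_d`: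
the norm closure of the algebra generated by the commuting copies of `M_d` at the sites. (On a
finite set of sites these copies generate the full matrix algebra `⨂ M_d`, so this is the
inductive limit of the local matrix algebras.) -/
abbrev QuasiLocal (d : ℕ) : Type :=
  ↥((StarAlgebra.adjoin ℂ (⋃ z : Site, Set.range (siteHom d z))).topologicalClosure)

instance (d : ℕ) : CStarAlgebra (QuasiLocal d) :=
  StarSubalgebra.cstarAlgebra
    (h_closed := StarSubalgebra.isClosed_topologicalClosure _)
    ((StarAlgebra.adjoin ℂ (⋃ z : Site, Set.range (siteHom d z))).topologicalClosure)

/-- The copy of `M_d` at the site `z`, inside `𝒜`. -/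
def site (d : ℕ) (z : Site) : Mat d →⋆ₐ[ℂ] QuasiLocal d :=
  (siteHom d z).codRestrict _ fun a =>
    StarSubalgebra.le_topologicalClosure _
      (StarAlgebra.subset_adjoin ℂ _ (Set.mem_iUnion.2 ⟨z, a, rfl⟩))

/-- The subalgebra `𝒜_Γ` of observables supported in a set `Γ` of sites. -/
def siteAlg (d : ℕ) (Γ : Set Site) : StarSubalgebra ℂ (QuasiLocal d) :=
  (StarAlgebra.adjoin ℂ (⋃ z ∈ Γ, Set.range (site d z))).topologicalClosure


/-- A norm closed `*`-subalgebra of `𝒜` that contains all one-site matrices is everything. -/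
theorem eq_top_of_site {d : ℕ} (S : StarSubalgebra ℂ (QuasiLocal d))
    (hc : IsClosed (S : Set (QuasiLocal d))) (h : ∀ z a, site d z a ∈ S) : S = ⊤ := by
  set B := (StarAlgebra.adjoin ℂ (⋃ z : Site, Set.range (siteHom d z))).topologicalClosure with hB
  have hcl : IsClosed ((S.map B.subtype : StarSubalgebra ℂ _) :
      Set (ConfigSpace d →L[ℂ] ConfigSpace d)) := by
    have h1 : IsClosed (B : Set (ConfigSpace d →L[ℂ] ConfigSpace d)) :=
      StarSubalgebra.isClosed_topologicalClosure _
    exact (h1.isClosedEmbedding_subtypeVal.isClosedMap) _ hc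
  have hle : B ≤ S.map B.subtype := by
    refine StarSubalgebra.topologicalClosure_minimal (StarAlgebra.adjoin_le ?_) hcl
    intro y hy
    obtain ⟨z, a, rfl⟩ := Set.mem_iUnion.1 hy
    exact ⟨site d z a, h z a, rfl⟩
  rw [eq_top_iff]
  rintro ⟨x, hx⟩ -
  obtain ⟨y, hy, hyx⟩ := hle hx
  have : y = ⟨x, hx⟩ := Subtype.ext hyx
  exact this ▸ hy

/-- Two `*`-homomorphisms on `𝒜` that agree on the one-site matrices are equal. -/
theorem hom_ext_site {d : ℕ} {Φ Ψ : QuasiLocal d →⋆ₐ[ℂ] QuasiLocal d}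
    (h : ∀ z a, Φ (site d z a) = Ψ (site d z a)) : Φ = Ψ := by
  have hΦ : Continuous Φ :=
    AddMonoidHomClass.continuous_of_bound Φ 1 fun a => by
      rw [one_mul]; exact NonUnitalStarAlgHom.norm_apply_le Φ a
  have hΨ : Continuous Ψ :=
    AddMonoidHomClass.continuous_of_bound Ψ 1 fun a => by
      rw [one_mul]; exact NonUnitalStarAlgHom.norm_apply_le Ψ a
  have := eq_top_of_site (StarAlgHom.equalizer Φ Ψ) (isClosed_eq hΦ hΨ) h
  ext1 a
  have ha : a ∈ StarAlgHom.equalizer Φ Ψ := this ▸ StarSubalgebra.mem_top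
  exact ha

theorem site_commute {d : ℕ} {z w : Site} (h : z ≠ w) (a b : Mat d) :
    Commute (site d z a) (site d w b) :=
  Subtype.ext (siteHom_commute h a b)

/-- A pointwise limit of `*`-homomorphisms of `𝒜` that converges on the one-site matrices. -/
theorem exists_limit_hom {d : ℕ} (Φ : ℕ → QuasiLocal d →⋆ₐ[ℂ] QuasiLocal d)
    (L : Site → Mat d → QuasiLocal d)
    (h : ∀ z a, Tendsto (fun n => Φ n (site d z a)) atTop (𝓝 (L z a))) :
    ∃ Ψ : QuasiLocal d →⋆ₐ[ℂ] QuasiLocal d, ∀ z a, Ψ (site d z a) = L z a := by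
  let S : StarSubalgebra ℂ (QuasiLocal d) :=
    { carrier := {a | ∃ l, Tendsto (fun n => Φ n a) atTop (𝓝 l)}
      mul_mem' := by
        rintro a b ⟨l, hl⟩ ⟨m, hm⟩
        exact ⟨l * m, by simpa using hl.mul hm⟩
      add_mem' := by
        rintro a b ⟨l, hl⟩ ⟨m, hm⟩
        exact ⟨l + m, by simpa using hl.add hm⟩
      algebraMap_mem' := fun c => ⟨algebraMap ℂ _ c, by
        simp only [AlgHomClass.commutes]; exact tendsto_const_nhds⟩
      star_mem' := by
        rintro a ⟨l, hl⟩
        exact ⟨star l, by simpa only [map_star] using hl.star⟩ }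
  have hS : IsClosed (S : Set (QuasiLocal d)) := by
    rw [← closure_subset_iff_isClosed]
    intro a ha
    show ∃ l, Tendsto (fun n => Φ n a) atTop (𝓝 l)
    apply cauchySeq_tendsto_of_complete
    rw [Metric.cauchySeq_iff']
    intro ε hε
    obtain ⟨b, ⟨l, hl⟩, hb⟩ := Metric.mem_closure_iff.1 ha (ε / 3) (by positivity)
    obtain ⟨N, hN⟩ := Metric.cauchySeq_iff'.1 hl.cauchySeq (ε / 3) (by positivity)
    refine ⟨N, fun n hn => ?_⟩
    have key : ∀ k, dist (Φ k a) (Φ k b) ≤ dist a b := fun k => by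
      rw [dist_eq_norm, dist_eq_norm, ← map_sub]
      exact NonUnitalStarAlgHom.norm_apply_le (Φ k) (a - b)
    have h1 := dist_triangle4 (Φ n a) (Φ n b) (Φ N b) (Φ N a)
    have h2 := hN n hn
    have h3 := key n
    have h4 := key N
    rw [dist_comm (Φ N a)] at h4
    linarith
  have htop : S = ⊤ := eq_top_of_site S hS fun z a => ⟨_, h z a⟩
  have hall : ∀ a, ∃ l, Tendsto (fun n => Φ n a) atTop (𝓝 l) := fun a => by
    have : a ∈ S := htop ▸ StarSubalgebra.mem_top
    exact this
  choose F hF using hall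
  refine ⟨{ toFun := F, map_one' := ?_, map_mul' := ?_, map_zero' := ?_, map_add' := ?_,
            commutes' := ?_, map_star' := ?_ }, fun z a => tendsto_nhds_unique (hF _) (h z a)⟩
  · exact tendsto_nhds_unique (hF 1) (by simp)
  · intro a b
    exact tendsto_nhds_unique (hF (a * b)) (by simpa using (hF a).mul (hF b))
  · exact tendsto_nhds_unique (hF 0) (by simp)
  · intro a b
    exact tendsto_nhds_unique (hF (a + b)) (by simpa using (hF a).add (hF b))
  · intro c
    exact tendsto_nhds_unique (hF _) (by
      simp only [AlgHomClass.commutes]; exact tendsto_const_nhds)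
  · intro a
    exact tendsto_nhds_unique (hF (star a)) (by simpa only [map_star] using (hF a).star)

/-- A unitary matrix placed at a site. -/
def siteUnitary (d : ℕ) (z : Site) (v : unitary (Mat d)) : unitary (QuasiLocal d) :=
  ⟨site d z v, Unitary.map_mem (site d z) v.2⟩

/-- Conjugation by `⨂ v` over the first `n` sites in an enumeration of the lattice. -/
def onSiteSeq {d : ℕ} (v : Site → unitary (Mat d)) : ℕ → (QuasiLocal d →⋆ₐ[ℂ] QuasiLocal d)
  | 0 => StarAlgHom.id ℂ _
  | n + 1 =>
    ((Unitary.conjStarAlgAut ℂ (QuasiLocal d) (siteUnitary d (Denumerable.ofNat Site n)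
      (v (Denumerable.ofNat Site n)))).toStarAlgHom).comp (onSiteSeq v n)

theorem onSiteSeq_succ {d : ℕ} (v : Site → unitary (Mat d)) (n : ℕ) (x : QuasiLocal d) :
    onSiteSeq v (n + 1) x =
      site d (Denumerable.ofNat Site n) (v (Denumerable.ofNat Site n)) * onSiteSeq v n x *
        star (site d (Denumerable.ofNat Site n) (v (Denumerable.ofNat Site n))) := rfl

theorem onSiteSeq_site {d : ℕ} (v : Site → unitary (Mat d)) (z : Site) (a : Mat d) (n : ℕ) :
    onSiteSeq v n (site d z a) =
      if Encodable.encode z < n then site d z (v z * a * star (v z : Mat d)) else site d z a := by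
  induction n with
  | zero => simp [onSiteSeq]
  | succ n ih =>
    rw [onSiteSeq_succ, ih]
    by_cases hz : Denumerable.ofNat Site n = z
    · have hn : Encodable.encode z = n := by
        rw [← hz, Denumerable.encode_ofNat]
      rw [hn, if_neg (lt_irrefl n), if_pos (Nat.lt_succ_self n), hz, ← map_star, ← map_mul,
        ← map_mul]
    · have hn : Encodable.encode z ≠ n := by
        rintro rfl
        exact hz (Denumerable.ofNat_encode z)
      have hiff : Encodable.encode z < n + 1 ↔ Encodable.encode z < n := by omega
      simp only [hiff]
      have comm : ∀ b : Mat d, site d (Denumerable.ofNat Site n) (v (Denumerable.ofNat Site n)) *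
          site d z b * star (site d (Denumerable.ofNat Site n) (v (Denumerable.ofNat Site n)))
            = site d z b := by
        intro b
        rw [(site_commute hz _ b).eq, mul_assoc, ← map_star, ← map_mul]
        simp
      split_ifs <;> exact comm _

theorem exists_onSite_hom {d : ℕ} (v : Site → unitary (Mat d)) :
    ∃ Φ : QuasiLocal d →⋆ₐ[ℂ] QuasiLocal d,
      ∀ z a, Φ (site d z a) = site d z (v z * a * star (v z : Mat d)) := by
  refine exists_limit_hom (onSiteSeq v) _ fun z a => ?_
  refine tendsto_const_nhds.congr' ?_
  filter_upwards [eventually_gt_atTop (Encodable.encode z)] with n hn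
  rw [onSiteSeq_site, if_pos hn]

/-- For a field `v` of one-site unitaries there is exactly one automorphism of `𝒜` that acts on
the observables at each site `z` as conjugation by `v z`. -/
theorem existsUnique_onSite {d : ℕ} (v : Site → unitary (Mat d)) :
    ∃! Φ : QuasiLocal d ≃⋆ₐ[ℂ] QuasiLocal d,
      ∀ z a, Φ (site d z a) = site d z (v z * a * star (v z : Mat d)) := by
  obtain ⟨Φ, hΦ⟩ := exists_onSite_hom v
  obtain ⟨Ψ, hΨ⟩ := exists_onSite_hom fun z => star (v z)
  have e1 : ∀ (w : unitary (Mat d)) (a : Mat d),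
      (star w : Mat d) * (w * a * star (w : Mat d)) * star (star w : Mat d) = a := by
    intro w a
    rw [star_star, mul_assoc, mul_assoc, mul_assoc, Unitary.coe_star_mul_self, mul_one,
      ← mul_assoc, Unitary.coe_star_mul_self, one_mul]
  have h1 : Ψ.comp Φ = StarAlgHom.id ℂ _ := hom_ext_site fun z a => by
    rw [StarAlgHom.comp_apply, hΦ, hΨ]
    exact congrArg (site d z) (e1 (v z) a)
  have h2 : Φ.comp Ψ = StarAlgHom.id ℂ _ := hom_ext_site fun z a => by
    rw [StarAlgHom.comp_apply, hΨ, hΦ]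
    have := e1 (star (v z)) a
    rw [Unitary.coe_star, star_star] at this
    rw [Unitary.coe_star, star_star]
    exact congrArg (site d z) this
  refine ⟨StarAlgEquiv.ofStarAlgHom Φ Ψ h1 h2, hΦ, fun Θ hΘ => ?_⟩
  have h3 : Θ.toStarAlgHom = Φ := hom_ext_site fun z a => (hΘ z a).trans (hΦ z a).symm
  ext1 x
  exact DFunLike.congr_fun h3 x

/-- The product automorphism `⨂_z Ad (v z)` of `𝒜`. -/
def onSite {d : ℕ} (v : Site → unitary (Mat d)) : QuasiLocal d ≃⋆ₐ[ℂ] QuasiLocal d :=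
  (existsUnique_onSite v).exists.choose

theorem onSite_site {d : ℕ} (v : Site → unitary (Mat d)) (z : Site) (a : Mat d) :
    onSite v (site d z a) = site d z (v z * a * star (v z : Mat d)) :=
  (existsUnique_onSite v).exists.choose_spec z a

/-! ## Regions of the plane, cones -/

/-- The Euclidean plane. -/
abbrev Plane : Type := EuclideanSpace ℝ (Fin 2)

/-- The sites of the lattice that lie in a region of the plane. -/
def sitesIn (X : Set Plane) : Set Site := {z | !₂[(z.1 : ℝ), (z.2 : ℝ)] ∈ X}

/-- `𝒜_X` for a region `X` of the plane. -/
def regionAlg (d : ℕ) (X : Set Plane) : StarSubalgebra ℂ (QuasiLocal d) := siteAlg d (sitesIn X)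

/-- The unit vector `e_θ`. -/
def dir (θ : ℝ) : Plane := !₂[Real.cos θ, Real.sin θ]

/-- The open cone `Λ_{a,θ,φ}` (used for `0 < φ < π`). -/
def cone (a : Plane) (θ φ : ℝ) : Set Plane :=
  {x | Real.cos φ * ‖x - a‖ < inner ℝ (x - a) (dir θ)}

/-- The closed arc `{e^{it} | t ∈ [θ - φ, θ + φ]}` of the circle; this is `arg Λ_{a,θ,φ}`. -/
def arc (θ φ : ℝ) : Set Circle := Circle.exp '' Set.Icc (θ - φ) (θ + φ)

/-- The right cone with apex `(s, 0)` and half-angle `φ`. -/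
def rightCone (s φ : ℝ) : Set Plane := cone !₂[s, 0] 0 φ

/-- The (closed) left cone with apex `(s, 0)` and half-angle `φ`, i.e. the closure of
`Λ_{(s,0),π,φ}`, written as the complement of a right cone. -/
def leftCone (s φ : ℝ) : Set Plane := (rightCone s (Real.pi - φ))ᶜ

/-- The open cones. -/
def openCones : Set (Set Plane) :=
  {Λ | ∃ (a : Plane) (θ φ : ℝ), 0 < φ ∧ φ < Real.pi ∧ Λ = cone a θ φ}

/-- A cone together with its parameters (for half-planes the set does not determine the apex):
an open cone `Λ_{a,θ,φ}`, or a left cone. -/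
inductive Cone : Type where
  | ofOpen (a : Plane) (θ φ : ℝ) (pos : 0 < φ) (lt : φ < Real.pi)
  | ofLeft (s φ : ℝ) (pos : 0 < φ) (lt : φ < Real.pi)

namespace Cone

/-- The underlying region of the plane. -/
def region : Cone → Set Plane
  | ofOpen a θ φ _ _ => cone a θ φ
  | ofLeft s φ _ _ => leftCone s φ

/-- The half-angle. -/
def angle : Cone → ℝ
  | ofOpen _ _ φ _ _ => φ
  | ofLeft _ φ _ _ => φ

/-- The fattened edge `(∂Λ)_ε = Λ_{a,θ+φ,ε} ∪ Λ_{a,θ-φ,ε}`; a left cone with apex `(s, 0)` has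
`θ = π`. -/
def edge : Cone → ℝ → Set Plane
  | ofOpen a θ φ _ _, ε => cone a (θ + φ) ε ∪ cone a (θ - φ) ε
  | ofLeft s φ _ _, ε => cone !₂[s, 0] (Real.pi + φ) ε ∪ cone !₂[s, 0] (Real.pi - φ) ε

/-- `Λ` is a left cone, i.e. belongs to `𝒞^l`. -/
def IsLeft : Cone → Prop
  | ofOpen _ _ _ _ _ => False
  | ofLeft _ _ _ _ => True

/-- The range of `ε` for which `(∂Λ)_ε` is considered:
`0 < ε < ½ min {|arg Λ|, 2π - |arg Λ|}`, where `|arg Λ|` is twice the half-angle. -/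
def Admissible (Λ : Cone) (ε : ℝ) : Prop := 0 < ε ∧ ε < min Λ.angle (Real.pi - Λ.angle)

end Cone

/-- The set `𝒞_{(θ,φ)}` of the cones whose closed arc of directions avoids
`{e^{it} | t ∈ [θ - φ, θ + φ]}`. -/
def conesAvoiding (θ φ : ℝ) : Set (Set Plane) :=
  {Λ | ∃ (a : Plane) (θ' φ' : ℝ), 0 < φ' ∧ φ' < Real.pi ∧ Λ = cone a θ' φ' ∧
    Disjoint (arc θ' φ') (arc θ φ)}

/-- The set `PC` of pairs of a left and a right cone that are disjoint and such that some
`ε`-fattening of the arc of directions of the left cone avoids that of the right cone. -/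
def PC : Set (Set Plane × Set Plane) :=
  {P | ∃ s φ₁ t φ₂ : ℝ, 0 < φ₁ ∧ φ₁ < Real.pi ∧ 0 < φ₂ ∧ φ₂ < Real.pi ∧
    P = (leftCone s φ₁, rightCone t φ₂) ∧ Disjoint (leftCone s φ₁) (rightCone t φ₂) ∧
    ∃ ε > 0, Disjoint (arc Real.pi (φ₁ + ε)) (arc 0 φ₂)}

/-! ## The symmetry -/

section Symmetry

variable {d : ℕ} {G : Type*} [Group G]

open Classical in
/-- The on-site action `β_g^X` of `g` on the sites in the region `X` (extended by the identity
from `𝒜_X` to `𝒜`). -/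
def onSiteAction (U : G →* unitary (Mat d)) (g : G) (X : Set Plane) :
    QuasiLocal d ≃⋆ₐ[ℂ] QuasiLocal d :=
  onSite fun z => if z ∈ sitesIn X then U g else 1

/-- `γ` is an automorphism of `𝒜_X`, extended by the identity on `𝒜_{Xᶜ}` to `𝒜`. -/
def IsAutOf (X : Set Plane) (γ : QuasiLocal d ≃⋆ₐ[ℂ] QuasiLocal d) : Prop :=
  γ '' (regionAlg d X : Set (QuasiLocal d)) = regionAlg d X ∧ ∀ A ∈ regionAlg d Xᶜ, γ A = A

end Symmetry

/-! ## States and representations -/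

/-- The states of `𝒜`: normalized positive linear functionals. -/
def states (d : ℕ) : Set (QuasiLocal d →ₗ[ℂ] ℂ) :=
  {ω | ω 1 = 1 ∧ ∀ A, 0 ≤ (ω (star A * A)).re ∧ (ω (star A * A)).im = 0}

/-- Pure states are the extreme points of the convex set of states. -/
def IsPureState {d : ℕ} (ω : QuasiLocal d →ₗ[ℂ] ℂ) : Prop := ω ∈ (states d).extremePoints ℝ

section Representations

variable {d : ℕ} {H : Type*} [NormedAddCommGroup H] [InnerProductSpace ℂ H] [CompleteSpace H]

/-- `(H, π, Ω)` is a GNS triple of `ω`. -/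
def IsGNSTriple (ω : QuasiLocal d →ₗ[ℂ] ℂ) (π : QuasiLocal d →⋆ₐ[ℂ] (H →L[ℂ] H)) (Ω : H) : Prop :=
  (∀ A, ω A = inner ℂ Ω (π A Ω)) ∧ Dense (Set.range fun A => π A Ω)

/-- A representation is irreducible if its commutant consists of the scalars. -/
def IsIrreducibleRep (ρ : QuasiLocal d →⋆ₐ[ℂ] (H →L[ℂ] H)) : Prop :=
  ∀ X : H →L[ℂ] H, (∀ A, X * ρ A = ρ A * X) → ∃ c : ℂ, X = c • (1 : H →L[ℂ] H)

variable (π : QuasiLocal d →⋆ₐ[ℂ] (H →L[ℂ] H))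

/-- The von Neumann algebra `π(𝒜_X)''`. -/
def localVN (X : Set Plane) : Set (H →L[ℂ] H) :=
  Set.centralizer (Set.centralizer (π '' (regionAlg d X : Set (QuasiLocal d))))

/-- The C*-algebra `ℱ`: the norm closure of the union of the `π(𝒜_{(Λ₁ ∪ Λ₂)ᶜ})''` over `PC`. -/
def algF : Set (H →L[ℂ] H) := closure (⋃ P ∈ PC, localVN π (P.1 ∪ P.2)ᶜ)

/-- The C*-algebra `ℬ_{(θ,φ)}`: the norm closure of the union of the `π(𝒜_Λ)''` over the cones
`Λ ∈ 𝒞_{(θ,φ)}`. -/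
def algB (θ φ : ℝ) : Set (H →L[ℂ] H) := closure (⋃ Λ ∈ conesAvoiding θ φ, localVN π Λ)

/-- The set `O` of the representations of `𝒜` on `H` that satisfy the superselection criterion
for `π`. -/
def superselection : Set (QuasiLocal d →⋆ₐ[ℂ] (H →L[ℂ] H)) :=
  {ρ | ∀ Λ ∈ openCones, ∃ V ∈ unitary (H →L[ℂ] H),
    ∀ A ∈ regionAlg d Λᶜ, V * ρ A * star V = π A}

section Localized

variable {G : Type*} [Group G] (U : G →* unitary (Mat d))

/-- The set `𝒱^{(g)}_{ρ(Λ₁,Λ₂)}` of the unitaries of `ℱ` that carry `ρ` to `π ∘ β_g^{Λ₁}` on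
`𝒜_{Λ₁ ∪ Λ₂}`. -/
def transporters (g : G) (ρ : QuasiLocal d →⋆ₐ[ℂ] (H →L[ℂ] H)) (P : Set Plane × Set Plane) :
    Set (H →L[ℂ] H) :=
  {V | V ∈ unitary (H →L[ℂ] H) ∧ V ∈ algF π ∧
    ∀ A ∈ regionAlg d (P.1 ∪ P.2), V * ρ A * star V = π (onSiteAction U g P.1 A)}

/-- The set `O^{(g)}` of `g`-localized sectors. -/
def localizedSectors (g : G) : Set (QuasiLocal d →⋆ₐ[ℂ] (H →L[ℂ] H)) :=
  {ρ | ρ ∈ superselection π ∧ ∀ P ∈ PC, (transporters π U g ρ P).Nonempty}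

/-- The set `O^{(g)}_{(Λ₁,Λ₂)}` of the `g`-localized sectors that equal `π ∘ β_g^{Λ₁}` on
`𝒜_{Λ₁ ∪ Λ₂}`. -/
def localizedSectorsAt (g : G) (P : Set Plane × Set Plane) :
    Set (QuasiLocal d →⋆ₐ[ℂ] (H →L[ℂ] H)) :=
  {ρ | ρ ∈ localizedSectors π U g ∧ 1 ∈ transporters π U g ρ P}

end Localized

/-- The σ-weak topology of `B(H)`, induced by the functionals `x ↦ ∑ ⟨ξ_n, x η_n⟩` for square
summable sequences `ξ`, `η` in `H`. -/
abbrev sigmaWeak (H : Type*) [NormedAddCommGroup H] [InnerProductSpace ℂ H] :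
    TopologicalSpace (H →L[ℂ] H) :=
  ⨅ (ξ : ℕ → H) (η : ℕ → H) (_ : Summable fun n => ‖ξ n‖ ^ 2) (_ : Summable fun n => ‖η n‖ ^ 2),
    TopologicalSpace.induced (fun x : H →L[ℂ] H => ∑' n, (inner ℂ (ξ n) (x (η n)) : ℂ)) inferInstance

/-- `T` is (on `ℬ = ℬ_{(0,φ₀)}`; its values elsewhere are irrelevant) the map `T_ρ` that
extends `ρ`: a `*`-homomorphism `ℬ → B(H)` with `T ∘ π = ρ` that is σ-weakly continuous on
`π(𝒜_Λ)''` for all `Λ ∈ 𝒞_{(0,φ₀)}`. -/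
structure IsExtension (φ₀ : ℝ) (ρ : QuasiLocal d →⋆ₐ[ℂ] (H →L[ℂ] H))
    (T : (H →L[ℂ] H) → (H →L[ℂ] H)) : Prop where
  map_add : ∀ x ∈ algB π 0 φ₀, ∀ y ∈ algB π 0 φ₀, T (x + y) = T x + T y
  map_smul : ∀ (c : ℂ), ∀ x ∈ algB π 0 φ₀, T (c • x) = c • T x
  map_mul : ∀ x ∈ algB π 0 φ₀, ∀ y ∈ algB π 0 φ₀, T (x * y) = T x * T y
  map_star : ∀ x ∈ algB π 0 φ₀, T (star x) = star (T x)
  sigmaWeak_continuousOn : ∀ Λ ∈ conesAvoiding 0 φ₀,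
    @ContinuousOn _ _ (sigmaWeak H) (sigmaWeak H) T (localVN π Λ)
  map_rep : ∀ A, T (π A) = ρ A

/-- The tensor product `ρ ⊗ σ := T_ρ T_σ π` is defined and equals `τ`. (The clause about all pairs
of extensions makes the notion independent of the choice of `T_ρ` and `T_σ`, which are in fact
unique on `ℬ_{(0,φ₀)}`.) -/
def IsTensor (φ₀ : ℝ) (ρ σ τ : QuasiLocal d →⋆ₐ[ℂ] (H →L[ℂ] H)) : Prop :=
  (∃ T, IsExtension π φ₀ ρ T) ∧ (∃ T, IsExtension π φ₀ σ T) ∧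
    ∀ Tρ Tσ, IsExtension π φ₀ ρ Tρ → IsExtension π φ₀ σ Tσ →
      ∀ A, Tσ (π A) ∈ algB π 0 φ₀ ∧ Tρ (Tσ (π A)) = τ A

section Excitation

variable {G : Type*} [Group G] (U : G →* unitary (Mat d))

/-- The subset `H` of `G`: those `g` for which there are an irreducible
`σ ∈ O^{(g)}_{(Λ₁,Λ₂)}` and some `σ' ∈ O^{(g⁻¹)}_{(Λ₁,Λ₂)}` with `σ' ⊗ σ = π`. -/
def anyonSubgroup (φ₀ : ℝ) (P : Set Plane × Set Plane) : Set G :=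
  {g | ∃ σ ∈ localizedSectorsAt π U g P, ∃ σ' ∈ localizedSectorsAt π U g⁻¹ P,
    IsIrreducibleRep σ ∧ IsTensor π φ₀ σ' σ π}

/-- `v` is the unitary on `H` that is determined by `v π(A) Ω = π(β γ⁻¹(A)) Ω`. -/
def IsImplementer (Ω : H) (β γ : QuasiLocal d ≃⋆ₐ[ℂ] QuasiLocal d) (v : H →L[ℂ] H) : Prop :=
  v ∈ unitary (H →L[ℂ] H) ∧ ∀ A, v (π A Ω) = π (β (γ.symm A)) Ω

/-- Local boundary excitation: `γ g Λ`, `γε g Λ ε`, `u g Λ ε` are the automorphisms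
`γ_{g,Λ} ∈ Aut 𝒜`, `γ_{g,Λ,ε} ∈ Aut 𝒜_{(∂Λ)_ε}` and the unitaries `u_{g,Λ,ε} ∈ 𝒰(𝒜)`; the
unitaries `v_{g,Λ}` on `H` are determined by them. -/
structure LocalBoundaryExcitation (ω : QuasiLocal d →ₗ[ℂ] ℂ) (Ω : H)
    (γ : G → Cone → (QuasiLocal d ≃⋆ₐ[ℂ] QuasiLocal d))
    (γε : G → Cone → ℝ → (QuasiLocal d ≃⋆ₐ[ℂ] QuasiLocal d))
    (u : G → Cone → ℝ → unitary (QuasiLocal d)) : Prop where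
  state_eq : ∀ g Λ A, ω (onSiteAction U g Λ.region A) = ω (γ g Λ A)
  edge_aut : ∀ g Λ ε, Λ.Admissible ε → IsAutOf (Λ.edge ε) (γε g Λ ε)
  factor : ∀ g Λ ε, Λ.Admissible ε → ∀ A,
    γ g Λ A = (u g Λ ε : QuasiLocal d) * γε g Λ ε A * star (u g Λ ε : QuasiLocal d)
  conj_mem : ∀ g Λ Λ', Λ.IsLeft → Λ'.IsLeft → ∀ v v' : H →L[ℂ] H,
    IsImplementer π Ω (onSiteAction U g Λ.region) (γ g Λ) v →
    IsImplementer π Ω (onSiteAction U g Λ'.region) (γ g Λ') v' →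
    ∀ x ∈ algF π, v * x * star v' ∈ algF π ∧ star v * x * v' ∈ algF π

/-- The representation `σ_g = π β_g^Λ γ_{g,Λ,ε}⁻¹`, where `γ = γ_{g,Λ,ε}`. -/
def sector (g : G) (Λ : Cone) (γ : QuasiLocal d ≃⋆ₐ[ℂ] QuasiLocal d) :
    QuasiLocal d →⋆ₐ[ℂ] (H →L[ℂ] H) :=
  π.comp (γ.symm.trans (onSiteAction U g Λ.region)).toStarAlgHom

/-- The representation `σ_g⁻¹ = π γ_{g,Λ,ε} (β_g^Λ)⁻¹`, where `γ = γ_{g,Λ,ε}`. -/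
def sectorInv (g : G) (Λ : Cone) (γ : QuasiLocal d ≃⋆ₐ[ℂ] QuasiLocal d) :
    QuasiLocal d →⋆ₐ[ℂ] (H →L[ℂ] H) :=
  π.comp ((onSiteAction U g Λ.region).symm.trans γ).toStarAlgHom

theorem sector_apply (g : G) (Λ : Cone) (γ : QuasiLocal d ≃⋆ₐ[ℂ] QuasiLocal d)
    (A : QuasiLocal d) :
    sector π U g Λ γ A = π (onSiteAction U g Λ.region (γ.symm A)) := rfl

theorem sectorInv_apply (g : G) (Λ : Cone) (γ : QuasiLocal d ≃⋆ₐ[ℂ] QuasiLocal d)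
    (A : QuasiLocal d) :
    sectorInv π U g Λ γ A = π (γ ((onSiteAction U g Λ.region).symm A)) := rfl

end Excitation

end Representations

end SET

end

/-!
Write `β = β_g^Λ`, `γ = γ_{g,Λ} = Ad(u) γ_ε`, and let `v` be the unitary with
`v π(A) Ω = π(β γ⁻¹(A)) Ω`; it exists because `ω β = ω γ` makes `β γ⁻¹` leave `ω` invariant
(`IsGNSTriple.exists_implementer`). Then `γ_ε⁻¹ = γ⁻¹ Ad(u)` gives
`σ_g = π β γ_ε⁻¹ = Ad(v π(u)) ∘ π`, and similarly `σ_g⁻¹ = π γ_ε β⁻¹ = Ad(v* π(b)) ∘ π` with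
`b = β γ⁻¹(u*)` (`conj_sector`, `conj_sectorInv`). So both representations are unitarily equivalent
to `π`: they satisfy the superselection criterion, they are irreducible because `ω` is pure
(`IsGNSTriple.isIrreducibleRep`), and conjugation by the unitary is the σ-weakly continuous
extension that the tensor product needs. As `σ_g` and `σ_g⁻¹` are `π` composed with mutually inverse
automorphisms of `𝒜`, their product is `π`.

The fattened edge of `Λ` and the region `Λ₁ ∪ Λ₂` are disjoint, so `γ_ε` is trivial on
`𝒜_{Λ₁ ∪ Λ₂}`, where `β_g^Λ` and `β_g^{Λ₁}` coincide; hence the representations are localized at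
`(Λ₁, Λ₂)`. For another pair `(Λ₁', Λ₂')` of `PC` there is a left cone `Λ'` with a fattened edge in
the gap between `Λ₁'` and `Λ₂'` (`exists_separating_leftCone`). With primes for the data of `Λ'`,
the unitary `v' π(u' u*) v*` carries `σ_g` to the representation for `Λ'`, which is localized at
`(Λ₁', Λ₂')`; in the case of `σ_g⁻¹` it is `v'* π(b' b*) v`. Both lie in `ℱ` by the assumed
stability of `ℱ`, since `π(𝒜) ⊆ ℱ` (`rep_mem_algF`): observables supported in vertical strips are
dense in `𝒜`, and every strip fits between the two cones of some pair in `PC`.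
-/

namespace SET

/-! ### Geometry of cones -/

theorem inner_dir (y : Plane) (θ : ℝ) :
    inner ℝ y (dir θ) = y 0 * Real.cos θ + y 1 * Real.sin θ := by
  simp [dir, PiLp.inner_apply, Fin.sum_univ_two, mul_comm]

/-- Polar coordinates, with the angle measured from a prescribed direction `α`. -/
theorem exists_polar (y : Plane) (α : ℝ) :
    ∃ η, |η| ≤ Real.pi ∧ ∀ θ, inner ℝ y (dir θ) = ‖y‖ * Real.cos (α + η - θ) := by
  set c : ℂ := ⟨y 0, y 1⟩ with hc
  set z : ℂ := c * Complex.exp (((-α : ℝ) : ℂ) * Complex.I) with hz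
  have hzn : ‖z‖ = ‖c‖ := by
    rw [hz, norm_mul, Complex.norm_exp_ofReal_mul_I, mul_one]
  have hcn : ‖c‖ = ‖y‖ := by
    rw [EuclideanSpace.norm_eq, Fin.sum_univ_two, Complex.norm_eq_sqrt_sq_add_sq]
    simp [hc]
  have hcz : c = ‖y‖ * Complex.exp (((α + z.arg : ℝ) : ℂ) * Complex.I) := by
    have h1 := Complex.norm_mul_exp_arg_mul_I z
    rw [hzn, hcn] at h1
    have h2 : c = z * Complex.exp ((α : ℂ) * Complex.I) := by
      rw [hz, mul_assoc, ← Complex.exp_add]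
      simp
    rw [h2]
    nth_rewrite 1 [← h1]
    rw [mul_assoc, ← Complex.exp_add]
    push_cast
    ring_nf
  refine ⟨z.arg, Complex.abs_arg_le_pi z, fun θ => ?_⟩
  have h0 : y 0 = ‖y‖ * Real.cos (α + z.arg) := by
    have := congrArg Complex.re hcz
    rwa [Complex.re_ofReal_mul, Complex.exp_ofReal_mul_I_re] at this
  have h1 : y 1 = ‖y‖ * Real.sin (α + z.arg) := by
    have := congrArg Complex.im hcz
    rwa [Complex.im_ofReal_mul, Complex.exp_ofReal_mul_I_im] at this
  rw [inner_dir, Real.cos_sub, h0, h1]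
  ring

theorem norm_axis_vector {r : ℝ} (h : 0 ≤ r) : ‖(!₂[r, 0] : Plane)‖ = r := by
  rw [EuclideanSpace.norm_eq]
  simp [Real.sqrt_sq h]

/-- The directions of the points of `Λ_{a,α,ε}` deviate from `α` by less than `ε`. -/
theorem exists_polar_of_mem_cone {a x : Plane} {α ε : ℝ} (hε : 0 < ε)
    (hx : x ∈ cone a α ε) :
    0 < ‖x - a‖ ∧ ∃ η, |η| < ε ∧
      ∀ θ, inner ℝ (x - a) (dir θ) = ‖x - a‖ * Real.cos (α + η - θ) := by
  obtain ⟨η, hη, h⟩ := exists_polar (x - a) α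
  have hx' : Real.cos ε * ‖x - a‖ < inner ℝ (x - a) (dir α) := hx
  have hpos : 0 < ‖x - a‖ := by
    refine lt_of_le_of_ne (norm_nonneg _) fun h0 => ?_
    rw [h α, ← h0] at hx'
    simp at hx'
  refine ⟨hpos, η, ?_, h⟩
  rw [h α, mul_comm, add_sub_cancel_left, ← Real.cos_abs η] at hx'
  have := lt_of_mul_lt_mul_left hx' hpos.le
  by_contra! hcon
  exact absurd this (not_lt.2 (Real.cos_le_cos_of_nonneg_of_le_pi hε.le hη hcon))

theorem mem_rightCone {s φ : ℝ} {x : Plane} :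
    x ∈ rightCone s φ ↔ Real.cos φ * ‖x - !₂[s, 0]‖ < x 0 - s := by
  simp [rightCone, cone, inner_dir]

theorem rightCone_mono_angle {s φ ψ : ℝ} (h0 : 0 ≤ φ) (h : φ ≤ ψ) (hπ : ψ ≤ Real.pi) :
    rightCone s φ ⊆ rightCone s ψ := by
  intro x hx
  rw [mem_rightCone] at hx ⊢
  exact lt_of_le_of_lt (mul_le_mul_of_nonneg_right
    (Real.cos_le_cos_of_nonneg_of_le_pi h0 hπ h) (norm_nonneg _)) hx

/-- Moving the apex of a right cone to the left enlarges the cone, whatever its half-angle. -/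
theorem rightCone_mono_apex {s t φ : ℝ} (h : s ≤ t) : rightCone t φ ⊆ rightCone s φ := by
  intro x hx
  rw [mem_rightCone] at hx ⊢
  have h1 : ‖(x - !₂[s, 0]) - (x - !₂[t, 0])‖ = t - s := by
    have : (x - !₂[s, 0]) - (x - !₂[t, 0]) = !₂[t - s, 0] := by
      ext i
      fin_cases i <;> simp
    rw [this, norm_axis_vector (sub_nonneg.2 h)]
  have h2 := abs_norm_sub_norm_le (x - !₂[s, 0]) (x - !₂[t, 0])
  rw [h1] at h2
  -- `r ↦ r - cos φ * ‖y + r e₀‖` is nondecreasing because the norm is `1`-Lipschitz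
  have h3 : Real.cos φ * (‖x - !₂[s, 0]‖ - ‖x - !₂[t, 0]‖) ≤ t - s := by
    refine (le_abs_self _).trans ?_
    rw [abs_mul]
    exact (mul_le_of_le_one_left (abs_nonneg _) (Real.abs_cos_le_one φ)).trans h2
  linarith

theorem leftCone_eq_compl (s φ : ℝ) : leftCone s φ = (rightCone s (Real.pi - φ))ᶜ := rfl

/-- Between the members of a pair in `PC` there is room for the fattened edge of a left cone. -/
theorem exists_separating_leftCone {Λ₁ Λ₂ : Set Plane} (hP : (Λ₁, Λ₂) ∈ PC) :
    ∃ (Λ : Cone) (ε : ℝ), Λ.IsLeft ∧ Λ.Admissible ε ∧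
      Λ.edge ε ⊆ (Λ₁ ∪ Λ₂)ᶜ ∧ Λ₁ ⊆ Λ.region ∧ Λ.region ⊆ Λ₂ᶜ := by
  obtain ⟨s, φ₁, t, φ₂, h1, h1', h2, h2', heq, hd, ε₀, hε₀, harc⟩ := hP
  obtain ⟨rfl, rfl⟩ := Prod.mk.inj heq
  have hsum : φ₁ + φ₂ < Real.pi := by
    by_contra! hcon
    refine Set.disjoint_left.1 harc (⟨Real.pi - φ₁, ⟨?_, ?_⟩, rfl⟩)
      ⟨_, ⟨?_, ?_⟩, rfl⟩ <;> linarith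
  have hst : s ≤ t := by
    by_contra! hcon
    refine Set.disjoint_left.1 hd (?_ : !₂[s, 0] ∈ _) ?_
    · rw [leftCone_eq_compl, Set.mem_compl_iff, mem_rightCone]
      simp
    · rw [mem_rightCone]
      have hn : ‖(!₂[s, 0] : Plane) - !₂[t, 0]‖ = s - t := by
        have : (!₂[s, 0] : Plane) - !₂[t, 0] = !₂[s - t, 0] := by
          ext i
          fin_cases i <;> simp
        rw [this, norm_axis_vector (sub_nonneg.2 hcon.le)]
      have hc : Real.cos φ₂ < 1 := by
        rw [← Real.cos_zero]
        exact Real.cos_lt_cos_of_nonneg_of_le_pi le_rfl h2'.le h2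
      rw [hn]
      simpa using mul_lt_of_lt_one_left (sub_pos.2 hcon) hc
  -- the bisector of the gap between the two cones, at the apex of the left one
  set φ := (φ₁ + (Real.pi - φ₂)) / 2 with hφ
  set ε := (Real.pi - φ₂ - φ₁) / 2 with hε
  have hε0 : 0 < ε := by linarith
  have hΛ₂ : rightCone t φ₂ ⊆ rightCone s φ₂ := rightCone_mono_apex hst
  -- points whose direction makes an angle in `(φ₁, π - φ₂)` with the negative axis
  have key : ∀ (x : Plane) (r τ : ℝ), 0 < r → φ₁ < τ → τ < Real.pi - φ₂ →
      ‖x - !₂[s, 0]‖ = r → x 0 - s = -(r * Real.cos τ) →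
      x ∈ (leftCone s φ₁ ∪ rightCone t φ₂)ᶜ := by
    intro x r τ hr hτ hτ' hn hx
    rintro (h | h)
    · apply h
      rw [mem_rightCone, hn, hx, Real.cos_pi_sub]
      have := Real.cos_lt_cos_of_nonneg_of_le_pi h1.le (by linarith) hτ
      nlinarith
    · have := mem_rightCone.1 (hΛ₂ h)
      rw [hn, hx] at this
      have h3 := Real.cos_lt_cos_of_nonneg_of_le_pi (by linarith : 0 ≤ τ) (by linarith) hτ'
      rw [Real.cos_pi_sub] at h3
      nlinarith
  refine ⟨.ofLeft s φ (by linarith) (by linarith), ε, trivial,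
    ⟨hε0, lt_min (show ε < φ by linarith) (show ε < Real.pi - φ by linarith)⟩, ?_, ?_, ?_⟩
  · rintro x (hx | hx)
    · obtain ⟨hr, η, hη, h⟩ := exists_polar_of_mem_cone hε0 hx
      have h0 := h 0
      rw [abs_lt] at hη
      refine key x _ (φ + η) hr (by linarith) (by linarith) rfl ?_
      rw [inner_dir, show Real.pi + φ + η - 0 = φ + η + Real.pi by ring, Real.cos_add_pi] at h0
      simpa using h0
    · obtain ⟨hr, η, hη, h⟩ := exists_polar_of_mem_cone hε0 hx
      have h0 := h 0
      rw [abs_lt] at hη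
      refine key x _ (φ - η) hr (by linarith) (by linarith) rfl ?_
      rw [inner_dir, show Real.pi - φ + η - 0 = Real.pi - (φ - η) by ring, Real.cos_pi_sub] at h0
      simpa using h0
  · exact Set.compl_subset_compl.2
      (rightCone_mono_angle (by linarith) (by linarith) (by linarith))
  · refine Set.compl_subset_compl.2 (hΛ₂.trans ?_)
    exact rightCone_mono_angle h2.le (by linarith) (by linarith)

/-- Arcs in the closed left and the open right half of the circle are disjoint. -/
theorem disjoint_arc_of_cos {θ φ θ' φ' : ℝ}
    (h : ∀ t ∈ Set.Icc (θ - φ) (θ + φ), Real.cos t ≤ 0)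
    (h' : ∀ t ∈ Set.Icc (θ' - φ') (θ' + φ'), 0 < Real.cos t) :
    Disjoint (arc θ φ) (arc θ' φ') := by
  rw [Set.disjoint_left]
  rintro _ ⟨t, ht, rfl⟩ ⟨t', ht', hexp⟩
  have h1 := congrArg (fun z : Circle => (z : ℂ).re) hexp
  simp only [Circle.coe_exp, Complex.exp_ofReal_mul_I_re] at h1
  have := h t ht
  have := h' t' ht'
  linarith

/-- The sites with first coordinate in `(-n, n)`. -/
def strip (n : ℕ) : Set Site := {z | |z.1| < n}

/-- The pair of cones of half-angle `π/4` with apexes `(-n, 0)` and `(n, 0)` leaves the strip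
free. -/
theorem exists_PC_strip (n : ℕ) : ∃ P ∈ PC, strip n ⊆ sitesIn (P.1 ∪ P.2)ᶜ := by
  have hπ := Real.pi_pos
  have hc : 0 < Real.cos (Real.pi / 4) :=
    Real.cos_pos_of_mem_Ioo ⟨by linarith, by linarith⟩
  have hl : ∀ x : Plane, -(n : ℝ) < x 0 → x ∉ leftCone (-n) (Real.pi / 4) := by
    intro x hx h
    apply h
    rw [mem_rightCone, Real.cos_pi_sub]
    have := mul_nonneg hc.le (norm_nonneg (x - !₂[-(n : ℝ), 0]))
    linarith
  have hr : ∀ x : Plane, x ∈ rightCone n (Real.pi / 4) → (n : ℝ) < x 0 := by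
    intro x hx
    rw [mem_rightCone] at hx
    have := mul_nonneg hc.le (norm_nonneg (x - !₂[(n : ℝ), 0]))
    linarith
  have hn : (0 : ℝ) ≤ n := n.cast_nonneg
  refine ⟨_, ⟨-n, Real.pi / 4, n, Real.pi / 4, by linarith, by linarith, by linarith, by linarith,
    rfl, Set.disjoint_left.2 fun x h h' => hl x (by linarith [hr x h']) h, Real.pi / 4, by linarith,
    disjoint_arc_of_cos ?_ ?_⟩, ?_⟩
  · rintro t ⟨h1, h2⟩
    exact Real.cos_nonpos_of_pi_div_two_le_of_le (by linarith) (by linarith)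
  · rintro t ⟨h1, h2⟩
    exact Real.cos_pos_of_mem_Ioo ⟨by linarith, by linarith⟩
  · intro z hz
    obtain ⟨h1, h2⟩ := abs_lt.1 (show |z.1| < (n : ℤ) from hz)
    have h1' : -(n : ℝ) < z.1 := by exact_mod_cast h1
    have h2' : (z.1 : ℝ) < n := by exact_mod_cast h2
    rintro (h | h)
    · exact hl _ (by simpa using h1') h
    · have := hr _ h
      simp at this
      linarith

/-- A left half-plane, seen as a cone of half-angle `π/2`, avoids the directions within `φ₀` of the
positive axis and contains the strip. -/
theorem exists_conesAvoiding_strip {φ₀ : ℝ} (hφ₀ : φ₀ < Real.pi / 2) (n : ℕ) :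
    ∃ Λ ∈ conesAvoiding 0 φ₀, strip n ⊆ sitesIn Λ := by
  have hπ := Real.pi_pos
  refine ⟨_, ⟨!₂[(n : ℝ), 0], Real.pi, Real.pi / 2, by linarith, by linarith, rfl,
    disjoint_arc_of_cos ?_ ?_⟩, ?_⟩
  · rintro t ⟨h1, h2⟩
    exact Real.cos_nonpos_of_pi_div_two_le_of_le (by linarith) (by linarith)
  · rintro t ⟨h1, h2⟩
    exact Real.cos_pos_of_mem_Ioo ⟨by linarith, by linarith⟩
  · intro z hz
    obtain ⟨-, h2⟩ := abs_lt.1 (show |z.1| < (n : ℤ) from hz)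
    have h2' : (z.1 : ℝ) < n := by exact_mod_cast h2
    show Real.cos (Real.pi / 2) * _ < inner ℝ _ _
    rw [inner_dir]
    simpa using h2'

/-! ### The local algebras -/

section LocalAlgebras

variable {d : ℕ}

theorem siteAlg_mono {Γ Δ : Set Site} (h : Γ ⊆ Δ) : siteAlg d Γ ≤ siteAlg d Δ :=
  StarSubalgebra.topologicalClosure_mono
    (StarAlgebra.adjoin_mono (Set.biUnion_subset_biUnion_left h))

theorem regionAlg_mono {X Y : Set Plane} (h : X ⊆ Y) : regionAlg d X ≤ regionAlg d Y :=
  siteAlg_mono fun _ hz => h hz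

theorem site_mem_siteAlg {Γ : Set Site} {z : Site} (hz : z ∈ Γ) (a : Mat d) :
    site d z a ∈ siteAlg d Γ :=
  StarSubalgebra.le_topologicalClosure _
    (StarAlgebra.subset_adjoin ℂ _ (Set.mem_biUnion hz ⟨a, rfl⟩))

theorem continuous_starAlgHom {A B : Type*} [CStarAlgebra A] [CStarAlgebra B] (Φ : A →⋆ₐ[ℂ] B) :
    Continuous Φ :=
  AddMonoidHomClass.continuous_of_bound Φ 1 fun a => by
    rw [one_mul]; exact NonUnitalStarAlgHom.norm_apply_le Φ a

/-- `*`-homomorphisms that agree on the one-site matrices in `X` agree on `𝒜_X`. -/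
theorem eqOn_regionAlg {X : Set Plane} {Φ Ψ : QuasiLocal d →⋆ₐ[ℂ] QuasiLocal d}
    (h : ∀ z ∈ sitesIn X, ∀ a, Φ (site d z a) = Ψ (site d z a)) :
    ∀ A ∈ regionAlg d X, Φ A = Ψ A := by
  have : regionAlg d X ≤ StarAlgHom.equalizer Φ Ψ := by
    refine StarSubalgebra.topologicalClosure_minimal (StarAlgebra.adjoin_le ?_)
      (isClosed_eq (continuous_starAlgHom Φ) (continuous_starAlgHom Ψ))
    intro y hy
    obtain ⟨z, hz, a, rfl⟩ := Set.mem_iUnion₂.1 hy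
    exact h z hz a
  exact fun A hA => this hA

/-- Observables supported in strips of finite width are dense. -/
theorem closure_iUnion_strip : closure (⋃ n, (siteAlg d (strip n) : Set (QuasiLocal d))) =
    Set.univ := by
  have hmono : Monotone fun n => siteAlg d (strip n) := fun m n hmn =>
    siteAlg_mono fun z hz => lt_of_lt_of_le (show |z.1| < (m : ℤ) from hz) (by exact_mod_cast hmn)
  let S : StarSubalgebra ℂ (QuasiLocal d) :=
    { carrier := ⋃ n, (siteAlg d (strip n) : Set (QuasiLocal d))
      mul_mem' := by
        intro a b ha hb
        obtain ⟨m, hm⟩ := Set.mem_iUnion.1 ha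
        obtain ⟨n, hn⟩ := Set.mem_iUnion.1 hb
        exact Set.mem_iUnion.2 ⟨max m n,
          mul_mem (hmono (le_max_left m n) hm) (hmono (le_max_right m n) hn)⟩
      add_mem' := by
        intro a b ha hb
        obtain ⟨m, hm⟩ := Set.mem_iUnion.1 ha
        obtain ⟨n, hn⟩ := Set.mem_iUnion.1 hb
        exact Set.mem_iUnion.2 ⟨max m n,
          add_mem (hmono (le_max_left m n) hm) (hmono (le_max_right m n) hn)⟩
      algebraMap_mem' := fun c => Set.mem_iUnion.2 ⟨0, algebraMap_mem _ c⟩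
      star_mem' := by
        intro a ha
        obtain ⟨m, hm⟩ := Set.mem_iUnion.1 ha
        exact Set.mem_iUnion.2 ⟨m, star_mem hm⟩ }
  have htop : S.topologicalClosure = ⊤ := by
    refine eq_top_of_site _ (StarSubalgebra.isClosed_topologicalClosure _) fun z a => ?_
    refine StarSubalgebra.le_topologicalClosure _ (Set.mem_iUnion.2 ⟨z.1.natAbs + 1, ?_⟩)
    refine site_mem_siteAlg ?_ a
    show |z.1| < ((z.1.natAbs + 1 : ℕ) : ℤ)
    rw [Int.abs_eq_natAbs]
    omega
  have := congrArg (fun T : StarSubalgebra ℂ (QuasiLocal d) => (T : Set (QuasiLocal d))) htop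
  rw [StarSubalgebra.topologicalClosure_coe] at this
  exact this

end LocalAlgebras

section Representations

variable {d : ℕ} {H : Type*} [NormedAddCommGroup H] [InnerProductSpace ℂ H] [CompleteSpace H]
  (π : QuasiLocal d →⋆ₐ[ℂ] (H →L[ℂ] H))

theorem rep_mem_closure_of_strip {C : Set (Set Plane)} (h : ∀ n, ∃ X ∈ C, strip n ⊆ sitesIn X)
    (A : QuasiLocal d) : π A ∈ closure (⋃ X ∈ C, localVN π X) := by
  have hA : A ∈ closure (⋃ n, (siteAlg d (strip n) : Set (QuasiLocal d))) := by
    rw [closure_iUnion_strip]; trivial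
  refine closure_mono ?_ (image_closure_subset_closure_image (continuous_starAlgHom π) ⟨A, hA, rfl⟩)
  rintro _ ⟨B, hB, rfl⟩
  obtain ⟨n, hn⟩ := Set.mem_iUnion.1 hB
  obtain ⟨X, hX, hsub⟩ := h n
  exact Set.mem_biUnion hX (Set.subset_centralizer_centralizer ⟨B, siteAlg_mono hsub hn, rfl⟩)

theorem rep_mem_algF (A : QuasiLocal d) : π A ∈ algF π := by
  have := rep_mem_closure_of_strip π (C := (fun P : Set Plane × Set Plane => (P.1 ∪ P.2)ᶜ) '' PC)
    (fun n => by
      obtain ⟨P, hP, h⟩ := exists_PC_strip n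
      exact ⟨_, ⟨P, hP, rfl⟩, h⟩) A
  rwa [Set.biUnion_image] at this

theorem rep_mem_algB {φ₀ : ℝ} (hφ₀ : φ₀ < Real.pi / 2) (A : QuasiLocal d) :
    π A ∈ algB π 0 φ₀ :=
  rep_mem_closure_of_strip π (exists_conesAvoiding_strip hφ₀) A

end Representations

/-! ### The on-site action -/

section Symmetry

variable {d : ℕ} {G : Type*} [Group G] (U : G →* unitary (Mat d)) (g : G)

theorem onSiteAction_site_of_mem {X : Set Plane} {z : Site} (hz : z ∈ sitesIn X) (a : Mat d) :
    onSiteAction U g X (site d z a) = site d z (U g * a * star (U g : Mat d)) := by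
  rw [onSiteAction, onSite_site, if_pos hz]

theorem onSiteAction_site_of_notMem {X : Set Plane} {z : Site} (hz : z ∉ sitesIn X) (a : Mat d) :
    onSiteAction U g X (site d z a) = site d z a := by
  rw [onSiteAction, onSite_site, if_neg hz]
  simp

theorem onSiteAction_symm (X : Set Plane) : (onSiteAction U g X).symm = onSiteAction U g⁻¹ X := by
  have h : (onSiteAction U g X : QuasiLocal d ≃⋆ₐ[ℂ] _).toStarAlgHom.comp
      (onSiteAction U g⁻¹ X).toStarAlgHom = StarAlgHom.id ℂ _ := hom_ext_site fun z a => by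
    show onSiteAction U g X (onSiteAction U g⁻¹ X (site d z a)) = site d z a
    by_cases hz : z ∈ sitesIn X
    · rw [onSiteAction_site_of_mem U _ hz, onSiteAction_site_of_mem U _ hz, map_inv,
        ← Unitary.star_eq_inv, Unitary.coe_star, star_star]
      congr 1
      rw [mul_assoc, mul_assoc, mul_assoc, Unitary.mul_star_self_of_mem (U g).2, mul_one,
        ← mul_assoc, Unitary.mul_star_self_of_mem (U g).2, one_mul]
    · rw [onSiteAction_site_of_notMem U _ hz, onSiteAction_site_of_notMem U _ hz]
  ext1 A
  rw [StarAlgEquiv.symm_apply_eq]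
  exact (DFunLike.congr_fun h A).symm

/-- On the sites of `Λ₁ ∪ Λ₂`, a region between `Λ₁` and the complement of `Λ₂` is seen as `Λ₁`. -/
theorem onSiteAction_site_eq {Λ₁ Λ₂ X : Set Plane} (h₁ : Λ₁ ⊆ X) (h₂ : X ⊆ Λ₂ᶜ) {z : Site}
    (hz : z ∈ sitesIn (Λ₁ ∪ Λ₂)) (a : Mat d) :
    onSiteAction U g X (site d z a) = onSiteAction U g Λ₁ (site d z a) := by
  by_cases hz1 : z ∈ sitesIn Λ₁
  · rw [onSiteAction_site_of_mem U g hz1,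
      onSiteAction_site_of_mem U g (show z ∈ sitesIn X from h₁ hz1)]
  · have hzX : z ∉ sitesIn X := fun hX => h₂ hX (hz.resolve_left hz1)
    rw [onSiteAction_site_of_notMem U g hz1, onSiteAction_site_of_notMem U g hzX]

end Symmetry

/-! ### GNS representations of pure states -/

theorem inner_self_eq_ofReal {H : Type*} [NormedAddCommGroup H] [InnerProductSpace ℂ H] (ξ : H) :
    inner ℂ ξ ξ = ((‖ξ‖ ^ 2 : ℝ) : ℂ) := by
  rw [inner_self_eq_norm_sq_to_K]
  norm_cast

section GNS

variable {d : ℕ} {H : Type*} [NormedAddCommGroup H] [InnerProductSpace ℂ H] [CompleteSpace H]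
  {ω : QuasiLocal d →ₗ[ℂ] ℂ} {π : QuasiLocal d →⋆ₐ[ℂ] (H →L[ℂ] H)} {Ω : H}

theorem IsGNSTriple.inner_eq (h : IsGNSTriple ω π Ω) (A B : QuasiLocal d) :
    inner ℂ (π A Ω) (π B Ω) = ω (star A * B) := by
  rw [h.1, map_mul, map_star, ContinuousLinearMap.star_eq_adjoint, mul_apply_eq_comp,
    ContinuousLinearMap.adjoint_inner_right]

/-- An automorphism that leaves a state invariant is implemented on its GNS space. -/
theorem IsGNSTriple.exists_implementer (h : IsGNSTriple ω π Ω)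
    (α : QuasiLocal d ≃⋆ₐ[ℂ] QuasiLocal d) (hα : ∀ A, ω (α A) = ω A) :
    ∃ v ∈ unitary (H →L[ℂ] H), (∀ A, v (π A Ω) = π (α A) Ω) := by
  let e : QuasiLocal d →ₗ[ℂ] H :=
    { toFun := fun A => π A Ω
      map_add' := fun A B => by simp
      map_smul' := fun c A => by simp }
  have hd : DenseRange e := h.2
  have hn : ∀ A, ‖e (α A)‖ = ‖e A‖ := fun A => by
    have : inner ℂ (π (α A) Ω) (π (α A) Ω) = inner ℂ (π A Ω) (π A Ω) := by
      rw [h.inner_eq, h.inner_eq, ← map_star, ← map_mul, hα]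
    rw [inner_self_eq_ofReal, inner_self_eq_ofReal] at this
    have h2 : ‖e (α A)‖ ^ 2 = ‖e A‖ ^ 2 := Complex.ofReal_injective this
    exact (sq_eq_sq₀ (norm_nonneg _) (norm_nonneg _)).1 h2
  let f : QuasiLocal d ≃ₗ[ℂ] QuasiLocal d := α.toAlgEquiv.toLinearEquiv
  let v : H ≃ₗᵢ[ℂ] H := f.extendOfIsometry e e hd hd hn
  refine ⟨v.toContinuousLinearEquiv.toContinuousLinearMap, ?_, fun A => ?_⟩
  · exact (Unitary.linearIsometryEquiv.symm v).2
  · exact f.extend_eq e e hd ⟨1, fun A => by rw [one_mul]; exact (hn A).le⟩ hd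
      ⟨1, fun A => by
        rw [one_mul, ← hn (f.symm A)]
        exact (congrArg (‖e ·‖) (f.apply_symm_apply A)).le⟩ A

/-- Operators that agree on the dense set `π(𝒜)Ω` are equal. -/
theorem IsGNSTriple.ext (h : IsGNSTriple ω π Ω) {S T : H →L[ℂ] H}
    (hST : ∀ A, S (π A Ω) = T (π A Ω)) : S = T := by
  refine ContinuousLinearMap.ext fun ξ => ?_
  exact congrFun (DenseRange.equalizer h.2 S.continuous T.continuous (funext hST)) ξ

theorem IsGNSTriple.conj_eq (h : IsGNSTriple ω π Ω) {α : QuasiLocal d ≃⋆ₐ[ℂ] QuasiLocal d}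
    {v : H →L[ℂ] H} (hv : v ∈ unitary (H →L[ℂ] H)) (hα : ∀ A, v (π A Ω) = π (α A) Ω)
    (A : QuasiLocal d) : v * π A * star v = π (α A) := by
  have : v * π A = π (α A) * v := h.ext fun B => by
    have h1 := hα (A * B)
    rw [map_mul, map_mul, map_mul, mul_apply_eq_comp, mul_apply_eq_comp, ← hα B] at h1
    rw [mul_apply_eq_comp, mul_apply_eq_comp, h1]
  rw [this, mul_assoc, Unitary.mul_star_self_of_mem hv, mul_one]

open ContinuousLinearMap in
/-- The commutant of the GNS representation of a pure state has only scalar elements `X` with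
`1/4 ≤ X ≤ 3/4`: such an `X` splits the state into `A ↦ ⟪Ω, X π(A) Ω⟫` and
`A ↦ ⟪Ω, (1 - X) π(A) Ω⟫`, both of positive mass. -/
theorem IsGNSTriple.eq_smul_one_of_bounds (h : IsGNSTriple ω π Ω) (hω : IsPureState ω)
    {X : H →L[ℂ] H} (hX : IsSelfAdjoint X) (hcomm : ∀ A, X * π A = π A * X)
    (hlow : ∀ ξ, 1 / 4 * ‖ξ‖ ^ 2 ≤ (inner ℂ ξ (X ξ)).re)
    (hupp : ∀ ξ, (inner ℂ ξ (X ξ)).re ≤ 3 / 4 * ‖ξ‖ ^ 2) :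
    ∃ c : ℂ, X = c • (1 : H →L[ℂ] H) := by
  have him : ∀ {Y : H →L[ℂ] H}, IsSelfAdjoint Y → ∀ ξ, (inner ℂ ξ (Y ξ)).im = 0 := by
    intro Y hY ξ
    have h1 : inner ℂ ξ (Y ξ) = inner ℂ (Y ξ) ξ := by
      nth_rewrite 1 [← hY.star_eq]
      rw [star_eq_adjoint, adjoint_inner_right]
    rw [← Complex.conj_eq_iff_im, inner_conj_symm, h1]
  -- an element `Y` of the commutant gives the sesquilinear form `(A, B) ↦ ⟪π(A) Ω, Y π(B) Ω⟫`
  let F : (H →L[ℂ] H) → (QuasiLocal d →ₗ[ℂ] ℂ) := fun Y =>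
    { toFun := fun A => inner ℂ Ω (Y (π A Ω))
      map_add' := fun A B => by simp
      map_smul' := fun c A => by simp }
  have hF : ∀ Y A, F Y A = inner ℂ Ω (Y (π A Ω)) := fun _ _ => rfl
  have hFpos : ∀ {Y : H →L[ℂ] H}, (∀ A, Y * π A = π A * Y) → ∀ A B,
      F Y (star A * B) = inner ℂ (π A Ω) (Y (π B Ω)) := by
    intro Y hY A B
    rw [hF, ← mul_apply_eq_comp, hY, map_mul, map_star, mul_assoc, ← hY, mul_apply_eq_comp,
      mul_apply_eq_comp, star_eq_adjoint, adjoint_inner_right]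
  have hΩ : ‖Ω‖ ^ 2 = 1 := by
    have h1 := h.inner_eq 1 1
    rw [star_one, one_mul, hω.1.1, map_one, one_apply_eq_self, inner_self_eq_ofReal] at h1
    exact Complex.ofReal_injective h1
  set r : ℝ := (inner ℂ Ω (X Ω)).re with hr
  have hr0 : 1 / 4 ≤ r := by simpa [hΩ] using hlow Ω
  have hr1 : r ≤ 3 / 4 := by simpa [hΩ] using hupp Ω
  have hrX : inner ℂ Ω (X Ω) = (r : ℂ) := Complex.ext rfl (by simpa using him hX Ω)
  have hstate : ∀ {Y : H →L[ℂ] H} {s : ℝ}, 0 < s → IsSelfAdjoint Y → (∀ A, Y * π A = π A * Y) →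
      (∀ ξ, 0 ≤ (inner ℂ ξ (Y ξ)).re) → inner ℂ Ω (Y Ω) = (s : ℂ) →
      ((s⁻¹ : ℝ) : ℂ) • F Y ∈ states d := by
    intro Y s hs hY hc hp hm
    refine ⟨?_, fun A => ?_⟩
    · rw [LinearMap.smul_apply, hF, map_one, one_apply_eq_self, hm, smul_eq_mul]
      push_cast
      exact inv_mul_cancel₀ (by exact_mod_cast hs.ne')
    · rw [LinearMap.smul_apply, hFpos hc, smul_eq_mul, Complex.re_ofReal_mul,
        Complex.im_ofReal_mul, him hY, mul_zero]
      exact ⟨mul_nonneg (inv_nonneg.2 hs.le) (hp _), rfl⟩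
  have hX1 := hstate (by linarith) hX hcomm
    (fun ξ => le_trans (by positivity) (hlow ξ)) hrX
  have hX2 := hstate (Y := 1 - X) (s := 1 - r) (by linarith) ((IsSelfAdjoint.one _).sub hX)
    (fun A => by rw [sub_mul, mul_sub, hcomm, one_mul, mul_one])
    (fun ξ => by
      rw [sub_apply, inner_sub_right, Complex.sub_re, one_apply_eq_self, inner_self_eq_ofReal]
      have := hupp ξ
      have h2 : (0 : ℝ) ≤ ‖ξ‖ ^ 2 := by positivity
      rw [Complex.ofReal_re]
      linarith)
    (by
      rw [sub_apply, inner_sub_right, one_apply_eq_self, inner_self_eq_ofReal, hrX, hΩ]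
      push_cast
      rfl)
  have hseg : ω ∈ openSegment ℝ (((r⁻¹ : ℝ) : ℂ) • F X) ((((1 - r)⁻¹ : ℝ) : ℂ) • F (1 - X)) := by
    refine ⟨r, 1 - r, by linarith, by linarith, by ring, ?_⟩
    ext A
    have e1 : (r : ℂ) ≠ 0 := by exact_mod_cast (by linarith : r ≠ 0)
    have e2 : ((1 - r : ℝ) : ℂ) ≠ 0 := by exact_mod_cast (by linarith : 1 - r ≠ 0)
    simp only [LinearMap.add_apply, LinearMap.smul_apply, Complex.real_smul, smul_eq_mul,
      Complex.ofReal_inv, mul_inv_cancel_left₀ e1, mul_inv_cancel_left₀ e2, hF, sub_apply,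
      one_apply_eq_self, inner_sub_right, add_sub_cancel]
    exact (h.1 A).symm
  have heq := hω.2 hX1 hX2 hseg
  refine ⟨r, h.ext fun B => ?_⟩
  have hker : ∀ A, inner ℂ (π A Ω) (X (π B Ω) - (r : ℂ) • π B Ω) = 0 := by
    intro A
    have h1 := DFunLike.congr_fun heq (star A * B)
    rw [LinearMap.smul_apply, hFpos hcomm, smul_eq_mul, ← h.inner_eq] at h1
    have e1 : (r : ℂ) ≠ 0 := by exact_mod_cast (by linarith : r ≠ 0)
    rw [inner_sub_right, inner_smul_right, ← h1]
    push_cast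
    rw [mul_inv_cancel_left₀ e1, sub_self]
  have hz : X (π B Ω) - (r : ℂ) • π B Ω = 0 := by
    exact DenseRange.eq_zero_of_inner_right (𝕜 := ℂ) h.2 hker
  simpa [sub_eq_zero] using hz

open ContinuousLinearMap in
/-- The GNS representation of a pure state is irreducible. -/
theorem IsGNSTriple.isIrreducibleRep (h : IsGNSTriple ω π Ω) (hω : IsPureState ω) :
    IsIrreducibleRep π := by
  have hsa : ∀ X : H →L[ℂ] H, IsSelfAdjoint X → (∀ A, X * π A = π A * X) →
      ∃ c : ℂ, X = c • (1 : H →L[ℂ] H) := by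
    intro X hX hcomm
    -- `X` is shifted and scaled so that its spectrum lies in `[1/4, 3/4]`
    set k : ℝ := (4 * ‖X‖ + 1)⁻¹ with hk
    have hk0 : 0 < k := by positivity
    have hkX : k * ‖X‖ ≤ 1 / 4 := by
      rw [hk, inv_mul_le_iff₀ (by positivity)]
      linarith
    have hb : ∀ ξ, |k * (inner ℂ ξ (X ξ)).re| ≤ 1 / 4 * ‖ξ‖ ^ 2 := by
      intro ξ
      rw [abs_mul, abs_of_pos hk0]
      have h1 : |(inner ℂ ξ (X ξ)).re| ≤ ‖X‖ * ‖ξ‖ ^ 2 := by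
        refine (Complex.abs_re_le_norm _).trans ((norm_inner_le_norm _ _).trans ?_)
        have := X.le_opNorm ξ
        nlinarith [norm_nonneg ξ]
      calc k * |(inner ℂ ξ (X ξ)).re| ≤ k * (‖X‖ * ‖ξ‖ ^ 2) := by gcongr
        _ = (k * ‖X‖) * ‖ξ‖ ^ 2 := by ring
        _ ≤ 1 / 4 * ‖ξ‖ ^ 2 := by gcongr
    have hre : ∀ ξ, (inner ℂ ξ ((((1 / 2 : ℝ) : ℂ) • (1 : H →L[ℂ] H) + (k : ℂ) • X) ξ)).re
        = 1 / 2 * ‖ξ‖ ^ 2 + k * (inner ℂ ξ (X ξ)).re := by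
      intro ξ
      rw [add_apply, smul_apply, smul_apply, one_apply_eq_self, inner_add_right, inner_smul_right,
        inner_smul_right, Complex.add_re, Complex.re_ofReal_mul, Complex.re_ofReal_mul,
        inner_self_eq_ofReal, Complex.ofReal_re]
    obtain ⟨c, hc⟩ := h.eq_smul_one_of_bounds hω
      (X := ((1 / 2 : ℝ) : ℂ) • (1 : H →L[ℂ] H) + (k : ℂ) • X)
      ((IsSelfAdjoint.smul (Complex.conj_ofReal _) (IsSelfAdjoint.one _)).add
        (IsSelfAdjoint.smul (Complex.conj_ofReal _) hX))
      (fun A => by simp [add_mul, mul_add, hcomm])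
      (fun ξ => by rw [hre]; linarith [(abs_le.1 (hb ξ)).1])
      (fun ξ => by rw [hre]; linarith [(abs_le.1 (hb ξ)).2])
    refine ⟨(k : ℂ)⁻¹ * (c - ((1 / 2 : ℝ) : ℂ)), ?_⟩
    have hk' : (k : ℂ) ≠ 0 := by exact_mod_cast hk0.ne'
    rw [mul_smul, sub_smul, ← hc, add_sub_cancel_left, smul_smul, inv_mul_cancel₀ hk', one_smul]
  intro X hX
  have hX' : ∀ A, star X * π A = π A * star X := fun A => by
    have := congrArg star (hX (star A))
    rw [star_mul, star_mul, ← map_star, star_star] at this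
    exact this.symm
  obtain ⟨a, ha⟩ := hsa (X + star X) (IsSelfAdjoint.add_star_self X)
    (fun A => by rw [add_mul, mul_add, hX, hX'])
  obtain ⟨b, hb⟩ := hsa (Complex.I • (X - star X))
    (by
      rw [IsSelfAdjoint, star_smul, star_sub, star_star]
      simp [smul_sub, neg_add_eq_sub])
    (fun A => by rw [smul_mul_assoc, mul_smul_comm, sub_mul, mul_sub, hX, hX'])
  refine ⟨(a - Complex.I * b) / 2, ?_⟩
  have h2 : X - star X = -(Complex.I * b) • (1 : H →L[ℂ] H) := by
    rw [neg_smul, mul_smul, ← hb, smul_smul, Complex.I_mul_I, neg_one_smul, neg_neg]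
  have h3 : (2 : ℂ) • X = (a - Complex.I * b) • (1 : H →L[ℂ] H) := by
    rw [sub_eq_add_neg, add_smul, ← ha, ← h2, two_smul]
    abel
  rw [div_eq_inv_mul, mul_smul, ← h3, smul_smul]
  simp

end GNS

/-! ### Representations unitarily equivalent to the reference representation -/

section Conjugates

variable {d : ℕ} {H : Type*} [NormedAddCommGroup H] [InnerProductSpace ℂ H] [CompleteSpace H]
  {π ρ : QuasiLocal d →⋆ₐ[ℂ] (H →L[ℂ] H)} {W : H →L[ℂ] H}

theorem star_conj_cancel (hW : W ∈ unitary (H →L[ℂ] H)) (x : H →L[ℂ] H) :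
    star W * (W * x * star W) * W = x := by
  rw [mul_assoc, mul_assoc, mul_assoc, Unitary.star_mul_self_of_mem hW, mul_one, ← mul_assoc,
    Unitary.star_mul_self_of_mem hW, one_mul]

theorem mem_superselection_of_conj (hW : W ∈ unitary (H →L[ℂ] H))
    (hρ : ∀ A, ρ A = W * π A * star W) : ρ ∈ superselection π := fun _ _ =>
  ⟨star W, Unitary.star_mem hW, fun A _ => by rw [hρ, star_star, star_conj_cancel hW]⟩

theorem IsIrreducibleRep.of_conj (hπ : IsIrreducibleRep π) (hW : W ∈ unitary (H →L[ℂ] H))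
    (hρ : ∀ A, ρ A = W * π A * star W) : IsIrreducibleRep ρ := by
  intro X hX
  obtain ⟨c, hc⟩ := hπ (star W * X * W) fun A => by
    have h1 := congrArg (fun T => star W * T * W) (hX A)
    simp only [hρ] at h1
    have e : star W * W = 1 := Unitary.star_mul_self_of_mem hW
    calc star W * X * W * π A = star W * X * W * π A * (star W * W) := by rw [e, mul_one]
      _ = star W * (X * (W * π A * star W)) * W := by simp only [mul_assoc]
      _ = star W * (W * π A * star W * X) * W := h1
      _ = (star W * W) * (π A * (star W * X * W)) := by simp only [mul_assoc]
      _ = π A * (star W * X * W) := by rw [e, one_mul]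
  refine ⟨c, ?_⟩
  have h2 := star_conj_cancel (Unitary.star_mem hW) X
  rw [star_star, hc] at h2
  rw [← h2, mul_smul_comm, mul_one, smul_mul_assoc, Unitary.mul_star_self_of_mem hW]

/-- Conjugation by a fixed operator is σ-weakly continuous: it moves the square summable sequences
that define the seminorms. -/
theorem continuous_sigmaWeak_conj (W : H →L[ℂ] H) :
    @Continuous _ _ (sigmaWeak H) (sigmaWeak H) fun x => W * x * star W := by
  simp only [continuous_iInf_rng, continuous_induced_rng]
  intro ξ η hξ hη
  have hs : ∀ {ζ : ℕ → H}, Summable (fun n => ‖ζ n‖ ^ 2) →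
      Summable fun n => ‖star W (ζ n)‖ ^ 2 := by
    intro ζ hζ
    refine Summable.of_nonneg_of_le (fun _ => by positivity) (fun n => ?_)
      (hζ.mul_left (‖star W‖ ^ 2))
    rw [← mul_pow]
    exact pow_le_pow_left₀ (norm_nonneg _) ((star W).le_opNorm _) 2
  have hfun : (fun x : H →L[ℂ] H => ∑' n, (inner ℂ (ξ n) (x (η n)) : ℂ)) ∘
      (fun x => W * x * star W) =
      fun x => ∑' n, (inner ℂ (star W (ξ n)) (x (star W (η n))) : ℂ) := by
    ext x
    refine tsum_congr fun n => ?_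
    rw [ContinuousLinearMap.star_eq_adjoint, ContinuousLinearMap.adjoint_inner_left]
    rfl
  rw [hfun]
  exact continuous_iff_le_induced.2 (iInf_le_of_le (fun n => star W (ξ n))
    (iInf_le_of_le (fun n => star W (η n)) (iInf_le_of_le (hs hξ) (iInf_le _ (hs hη)))))

theorem isExtension_conj (φ₀ : ℝ) (hW : W ∈ unitary (H →L[ℂ] H))
    (hρ : ∀ A, ρ A = W * π A * star W) : IsExtension π φ₀ ρ fun x => W * x * star W where
  map_add x _ y _ := by rw [mul_add, add_mul]
  map_smul c x _ := by rw [mul_smul_comm, smul_mul_assoc]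
  map_mul x _ y _ := by
    calc W * (x * y) * star W = W * x * 1 * (y * star W) := by simp only [mul_assoc, one_mul]
      _ = W * x * star W * (W * y * star W) := by
        rw [← Unitary.star_mul_self_of_mem hW]
        simp only [mul_assoc]
  map_star x _ := by simp only [star_mul, star_star, mul_assoc]
  sigmaWeak_continuousOn _ _ :=
    @Continuous.continuousOn _ _ (sigmaWeak H) (sigmaWeak H) _ _ (continuous_sigmaWeak_conj W)
  map_rep A := (hρ A).symm

/-- If `ρ = Ad(W) ∘ π` and `Ad(W') ∘ π` is localized at `Q`, then `W' W*` transports `ρ` to `Q`. -/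
theorem mem_localizedSectorsAt_of_conj {G : Type*} [Group G] {U : G →* unitary (Mat d)} {g : G}
    {P : Set Plane × Set Plane} (hW : W ∈ unitary (H →L[ℂ] H))
    (hρ : ∀ A, ρ A = W * π A * star W)
    (hP : ∀ A ∈ regionAlg d (P.1 ∪ P.2), ρ A = π (onSiteAction U g P.1 A))
    (htr : ∀ Q ∈ PC, ∃ W' ∈ unitary (H →L[ℂ] H), W' * star W ∈ algF π ∧
      ∀ A ∈ regionAlg d (Q.1 ∪ Q.2), W' * π A * star W' = π (onSiteAction U g Q.1 A)) :
    ρ ∈ localizedSectorsAt π U g P := by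
  refine ⟨⟨mem_superselection_of_conj hW hρ, fun Q hQ => ?_⟩, one_mem _, ?_, fun A hA => ?_⟩
  · obtain ⟨W', hW', hF, h⟩ := htr Q hQ
    refine ⟨W' * star W, mul_mem hW' (Unitary.star_mem hW), hF, fun A hA => ?_⟩
    rw [← h A hA, hρ, star_mul, star_star]
    calc W' * star W * (W * π A * star W) * (W * star W')
        = W' * (star W * (W * π A * star W) * W) * star W' := by simp only [mul_assoc]
      _ = W' * π A * star W' := by rw [star_conj_cancel hW]
  · simpa using rep_mem_algF π 1
  · rw [star_one, one_mul, mul_one, hP A hA]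

end Conjugates

/-! ### The sectors of the local boundary excitation -/

section Excitation

variable {d : ℕ} {H : Type*} [NormedAddCommGroup H] [InnerProductSpace ℂ H] [CompleteSpace H]
  {π : QuasiLocal d →⋆ₐ[ℂ] (H →L[ℂ] H)} {Ω : H}
  {G : Type*} [Group G] {U : G →* unitary (Mat d)} {ω : QuasiLocal d →ₗ[ℂ] ℂ}
  {γ : G → Cone → (QuasiLocal d ≃⋆ₐ[ℂ] QuasiLocal d)}
  {γε : G → Cone → ℝ → (QuasiLocal d ≃⋆ₐ[ℂ] QuasiLocal d)}
  {u : G → Cone → ℝ → unitary (QuasiLocal d)}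

theorem IsImplementer.conj_eq (hGNS : IsGNSTriple ω π Ω) {β γ₀ : QuasiLocal d ≃⋆ₐ[ℂ] QuasiLocal d}
    {v : H →L[ℂ] H} (hv : IsImplementer π Ω β γ₀ v) (A : QuasiLocal d) :
    v * π A * star v = π (β (γ₀.symm A)) :=
  hGNS.conj_eq (α := γ₀.symm.trans β) hv.1 hv.2 A

theorem IsImplementer.star_conj_eq (hGNS : IsGNSTriple ω π Ω)
    {β γ₀ : QuasiLocal d ≃⋆ₐ[ℂ] QuasiLocal d} {v : H →L[ℂ] H} (hv : IsImplementer π Ω β γ₀ v)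
    (A : QuasiLocal d) : star v * π A * v = π (γ₀ (β.symm A)) := by
  rw [← star_conj_cancel hv.1 (π (γ₀ (β.symm A))), hv.conj_eq hGNS]
  simp

/-- The unitary that carries `π` to `π β γ₁⁻¹`, where `v` implements `β γ₀⁻¹` and
`γ₀ = Ad(w) γ₁`. -/
theorem conj_sector (hGNS : IsGNSTriple ω π Ω) {β γ₀ γ₁ : QuasiLocal d ≃⋆ₐ[ℂ] QuasiLocal d}
    {w : unitary (QuasiLocal d)}
    (hγ : ∀ A, γ₀ A = (w : QuasiLocal d) * γ₁ A * star (w : QuasiLocal d)) {v : H →L[ℂ] H}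
    (hv : IsImplementer π Ω β γ₀ v) (A : QuasiLocal d) :
    (v * π w) * π A * star (v * π w) = π (β (γ₁.symm A)) := by
  have h1 : γ₀.symm (w * A * star (w : QuasiLocal d)) = γ₁.symm A := by
    rw [StarAlgEquiv.symm_apply_eq, hγ, StarAlgEquiv.apply_symm_apply]
  rw [← h1, ← hv.conj_eq hGNS, star_mul, map_mul, map_mul, map_star]
  simp only [mul_assoc]

/-- The unitary that carries `π` to `π γ₁ β⁻¹`, where `v` implements `β γ₀⁻¹` and
`γ₀ = Ad(w) γ₁`. The factor from `𝒜` is moved to the right of `v*` so that `v*` stands on the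
outside, as the invariance of `ℱ` under `x ↦ v'* x v` demands. -/
theorem conj_sectorInv (hGNS : IsGNSTriple ω π Ω) {β γ₀ γ₁ : QuasiLocal d ≃⋆ₐ[ℂ] QuasiLocal d}
    {w : unitary (QuasiLocal d)}
    (hγ : ∀ A, γ₀ A = (w : QuasiLocal d) * γ₁ A * star (w : QuasiLocal d)) {v : H →L[ℂ] H}
    (hv : IsImplementer π Ω β γ₀ v) (A : QuasiLocal d) :
    (star v * π (β (γ₀.symm (star (w : QuasiLocal d))))) * π A *
      star (star v * π (β (γ₀.symm (star (w : QuasiLocal d))))) = π (γ₁ (β.symm A)) := by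
  set b := β (γ₀.symm (star (w : QuasiLocal d))) with hb
  have h1 : γ₀ (β.symm (b * A * star b)) = γ₁ (β.symm A) := by
    rw [hb]
    simp only [map_mul, map_star, StarAlgEquiv.symm_apply_apply, StarAlgEquiv.apply_symm_apply,
      star_star]
    rw [hγ]
    calc star (w : QuasiLocal d) * (w * γ₁ (β.symm A) * star (w : QuasiLocal d)) * w
        = (star (w : QuasiLocal d) * w) * γ₁ (β.symm A) * (star (w : QuasiLocal d) * w) := by
          simp only [mul_assoc]
      _ = γ₁ (β.symm A) := by rw [Unitary.star_mul_self_of_mem w.2, one_mul, mul_one]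
  rw [← h1, ← hv.star_conj_eq hGNS, star_mul, star_star, map_mul, map_mul, map_star]
  simp only [mul_assoc]

theorem LocalBoundaryExcitation.exists_implementer
    (hexc : LocalBoundaryExcitation π U ω Ω γ γε u) (hGNS : IsGNSTriple ω π Ω) (g : G) (Λ : Cone) :
    ∃ v, IsImplementer π Ω (onSiteAction U g Λ.region) (γ g Λ) v := by
  obtain ⟨v, hv, h⟩ := hGNS.exists_implementer ((γ g Λ).symm.trans (onSiteAction U g Λ.region))
    fun A => (hexc.state_eq g Λ _).trans (congrArg ω ((γ g Λ).apply_symm_apply A))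
  exact ⟨v, hv, h⟩

section Localization

variable {Λ : Cone} {X Λ₁ Λ₂ : Set Plane} {γ₁ : QuasiLocal d ≃⋆ₐ[ℂ] QuasiLocal d}

theorem IsAutOf.apply_eq_self (hγ : IsAutOf X γ₁) (hX : X ⊆ (Λ₁ ∪ Λ₂)ᶜ) {A : QuasiLocal d}
    (hA : A ∈ regionAlg d (Λ₁ ∪ Λ₂)) : γ₁ A = A :=
  hγ.2 A (regionAlg_mono (Set.subset_compl_comm.1 hX) hA)

theorem sector_eq_of_mem (π : QuasiLocal d →⋆ₐ[ℂ] (H →L[ℂ] H)) (U : G →* unitary (Mat d)) (g : G)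
    (hγ : IsAutOf X γ₁) (hX : X ⊆ (Λ₁ ∪ Λ₂)ᶜ) (h₁ : Λ₁ ⊆ Λ.region) (h₂ : Λ.region ⊆ Λ₂ᶜ)
    {A : QuasiLocal d} (hA : A ∈ regionAlg d (Λ₁ ∪ Λ₂)) :
    sector π U g Λ γ₁ A = π (onSiteAction U g Λ₁ A) := by
  have h : γ₁.symm A = A := by
    rw [StarAlgEquiv.symm_apply_eq, hγ.apply_eq_self hX hA]
  rw [sector_apply, h]
  exact congrArg π (eqOn_regionAlg (Φ := (onSiteAction U g Λ.region).toStarAlgHom)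
    (Ψ := (onSiteAction U g Λ₁).toStarAlgHom)
    (fun z hz a => onSiteAction_site_eq U g h₁ h₂ hz a) A hA)

theorem sectorInv_eq_of_mem (π : QuasiLocal d →⋆ₐ[ℂ] (H →L[ℂ] H)) (U : G →* unitary (Mat d))
    (g : G) (hγ : IsAutOf X γ₁) (hX : X ⊆ (Λ₁ ∪ Λ₂)ᶜ) (h₁ : Λ₁ ⊆ Λ.region) (h₂ : Λ.region ⊆ Λ₂ᶜ)
    {A : QuasiLocal d} (hA : A ∈ regionAlg d (Λ₁ ∪ Λ₂)) :
    sectorInv π U g Λ γ₁ A = π (onSiteAction U g⁻¹ Λ₁ A) := by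
  rw [sectorInv_apply, onSiteAction_symm]
  refine congrArg π (eqOn_regionAlg
    (Φ := γ₁.toStarAlgHom.comp (onSiteAction U g⁻¹ Λ.region).toStarAlgHom)
    (Ψ := (onSiteAction U g⁻¹ Λ₁).toStarAlgHom) (fun z hz a => ?_) A hA)
  show γ₁ (onSiteAction U g⁻¹ Λ.region (site d z a)) = onSiteAction U g⁻¹ Λ₁ (site d z a)
  rw [onSiteAction_site_eq U g⁻¹ h₁ h₂ hz]
  refine hγ.apply_eq_self hX ?_
  by_cases hz1 : z ∈ sitesIn Λ₁
  · rw [onSiteAction_site_of_mem U g⁻¹ hz1]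
    exact site_mem_siteAlg hz _
  · rw [onSiteAction_site_of_notMem U g⁻¹ hz1]
    exact site_mem_siteAlg hz _

end Localization

variable {Λ : Cone} {ε : ℝ} {Λ₁ Λ₂ : Set Plane}

theorem sector_mem_localizedSectorsAt (hexc : LocalBoundaryExcitation π U ω Ω γ γε u)
    (hGNS : IsGNSTriple ω π Ω) (hl : Λ.IsLeft) (hε : Λ.Admissible ε)
    (hedge : Λ.edge ε ⊆ (Λ₁ ∪ Λ₂)ᶜ) (h₁ : Λ₁ ⊆ Λ.region) (h₂ : Λ.region ⊆ Λ₂ᶜ) (g : G) :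
    sector π U g Λ (γε g Λ ε) ∈ localizedSectorsAt π U g (Λ₁, Λ₂) := by
  obtain ⟨v, hv⟩ := hexc.exists_implementer hGNS g Λ
  refine mem_localizedSectorsAt_of_conj (mul_mem hv.1 (Unitary.map_mem π (u g Λ ε).2))
    (fun A => (conj_sector hGNS (hexc.factor g Λ ε hε) hv A).symm)
    (fun A hA => sector_eq_of_mem π U g (hexc.edge_aut g Λ ε hε) hedge h₁ h₂ hA) ?_
  rintro ⟨Q₁, Q₂⟩ hQ
  obtain ⟨Λ', ε', hl', hε', hedge', h₁', h₂'⟩ := exists_separating_leftCone hQ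
  obtain ⟨v', hv'⟩ := hexc.exists_implementer hGNS g Λ'
  refine ⟨v' * π (u g Λ' ε'), mul_mem hv'.1 (Unitary.map_mem π (u g Λ' ε').2), ?_, fun A hA => ?_⟩
  · have := (hexc.conj_mem g Λ' Λ hl' hl v' v hv' hv _
      (rep_mem_algF π (u g Λ' ε' * star (u g Λ ε : QuasiLocal d)))).1
    rw [map_mul, map_star] at this
    simpa only [star_mul, mul_assoc] using this
  · rw [conj_sector hGNS (hexc.factor g Λ' ε' hε') hv']
    exact sector_eq_of_mem π U g (hexc.edge_aut g Λ' ε' hε') hedge' h₁' h₂' hA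

theorem sectorInv_mem_localizedSectorsAt (hexc : LocalBoundaryExcitation π U ω Ω γ γε u)
    (hGNS : IsGNSTriple ω π Ω) (hl : Λ.IsLeft) (hε : Λ.Admissible ε)
    (hedge : Λ.edge ε ⊆ (Λ₁ ∪ Λ₂)ᶜ) (h₁ : Λ₁ ⊆ Λ.region) (h₂ : Λ.region ⊆ Λ₂ᶜ) (g : G) :
    sectorInv π U g Λ (γε g Λ ε) ∈ localizedSectorsAt π U g⁻¹ (Λ₁, Λ₂) := by
  have hu : ∀ (Λ : Cone) (ε : ℝ) (v : H →L[ℂ] H),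
      IsImplementer π Ω (onSiteAction U g Λ.region) (γ g Λ) v →
      star v * π (onSiteAction U g Λ.region ((γ g Λ).symm (star (u g Λ ε : QuasiLocal d)))) ∈
        unitary (H →L[ℂ] H) := fun Λ ε v hv =>
    mul_mem (Unitary.star_mem hv.1) (Unitary.map_mem π (Unitary.map_mem _ (Unitary.map_mem _
      (Unitary.star_mem (u g Λ ε).2))))
  obtain ⟨v, hv⟩ := hexc.exists_implementer hGNS g Λ
  refine mem_localizedSectorsAt_of_conj (hu Λ ε v hv)
    (fun A => (conj_sectorInv hGNS (hexc.factor g Λ ε hε) hv A).symm)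
    (fun A hA => sectorInv_eq_of_mem π U g (hexc.edge_aut g Λ ε hε) hedge h₁ h₂ hA) ?_
  rintro ⟨Q₁, Q₂⟩ hQ
  obtain ⟨Λ', ε', hl', hε', hedge', h₁', h₂'⟩ := exists_separating_leftCone hQ
  obtain ⟨v', hv'⟩ := hexc.exists_implementer hGNS g Λ'
  refine ⟨_, hu Λ' ε' v' hv', ?_, fun A hA => ?_⟩
  · have := (hexc.conj_mem g Λ' Λ hl' hl v' v hv' hv _ (rep_mem_algF π
      (onSiteAction U g Λ'.region ((γ g Λ').symm (star (u g Λ' ε' : QuasiLocal d))) *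
        star (onSiteAction U g Λ.region ((γ g Λ).symm (star (u g Λ ε : QuasiLocal d))))))).2
    rw [map_mul, map_star π] at this
    simpa only [star_mul, star_star, mul_assoc] using this
  · rw [conj_sectorInv hGNS (hexc.factor g Λ' ε' hε') hv']
    exact sectorInv_eq_of_mem π U g (hexc.edge_aut g Λ' ε' hε') hedge' h₁' h₂' hA

theorem isTensor_sectorInv_sector (hexc : LocalBoundaryExcitation π U ω Ω γ γε u)
    (hGNS : IsGNSTriple ω π Ω) {φ₀ : ℝ} (hφ₀ : φ₀ < Real.pi / 2) (hε : Λ.Admissible ε) (g : G) :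
    IsTensor π φ₀ (sectorInv π U g Λ (γε g Λ ε)) (sector π U g Λ (γε g Λ ε)) π := by
  obtain ⟨v, hv⟩ := hexc.exists_implementer hGNS g Λ
  refine ⟨⟨_, isExtension_conj φ₀ (mul_mem (Unitary.star_mem hv.1) (Unitary.map_mem π
      (Unitary.map_mem _ (Unitary.map_mem _ (Unitary.star_mem (u g Λ ε).2)))))
      fun A => (conj_sectorInv hGNS (hexc.factor g Λ ε hε) hv A).symm⟩,
    ⟨_, isExtension_conj φ₀ (mul_mem hv.1 (Unitary.map_mem π (u g Λ ε).2))
      fun A => (conj_sector hGNS (hexc.factor g Λ ε hε) hv A).symm⟩, fun T S hT hS A => ?_⟩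
  rw [hS.map_rep, sector_apply, hT.map_rep, sectorInv_apply]
  exact ⟨rep_mem_algB π hφ₀ _, by simp⟩

theorem isIrreducibleRep_sector (hexc : LocalBoundaryExcitation π U ω Ω γ γε u)
    (hGNS : IsGNSTriple ω π Ω) (hω : IsPureState ω) (hε : Λ.Admissible ε) (g : G) :
    IsIrreducibleRep (sector π U g Λ (γε g Λ ε)) := by
  obtain ⟨v, hv⟩ := hexc.exists_implementer hGNS g Λ
  exact (hGNS.isIrreducibleRep hω).of_conj (mul_mem hv.1 (Unitary.map_mem π (u g Λ ε).2))
    fun A => (conj_sector hGNS (hexc.factor g Λ ε hε) hv A).symm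

end Excitation

end SET

theorem lemma3p7 {d : ℕ} (hd : 2 ≤ d)
    {G : Type*} [Group G] [Finite G] (U : G →* unitary (SET.Mat d))
    (hU : Function.Injective fun g => Unitary.conjStarAlgAut ℂ (SET.Mat d) (U g))
    {H : Type*} [NormedAddCommGroup H] [InnerProductSpace ℂ H] [CompleteSpace H]
    (ω : SET.QuasiLocal d →ₗ[ℂ] ℂ) (hω : SET.IsPureState ω)
    (π : SET.QuasiLocal d →⋆ₐ[ℂ] (H →L[ℂ] H)) (Ω : H) (hGNS : SET.IsGNSTriple ω π Ω)
    (hinv : ∀ g A, ω (SET.onSiteAction U g Set.univ A) = ω A)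
    {φ₀ : ℝ} (hφ₀ : 0 < φ₀) (hφ₀' : φ₀ < Real.pi / 2)
    (Λ₁ Λ₂ : Set SET.Plane) (hPC : (Λ₁, Λ₂) ∈ SET.PC)
    (γ : G → SET.Cone → (SET.QuasiLocal d ≃⋆ₐ[ℂ] SET.QuasiLocal d))
    (γε : G → SET.Cone → ℝ → (SET.QuasiLocal d ≃⋆ₐ[ℂ] SET.QuasiLocal d))
    (u : G → SET.Cone → ℝ → unitary (SET.QuasiLocal d))
    (hexc : SET.LocalBoundaryExcitation π U ω Ω γ γε u) :
    (∀ (Λ : SET.Cone) (ε : ℝ), Λ.IsLeft → Λ.Admissible ε →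
      Λ.edge ε ⊆ (Λ₁ ∪ Λ₂)ᶜ → Λ₁ ⊆ Λ.region → Λ.region ⊆ Λ₂ᶜ →
      ∀ g : G,
        SET.sector π U g Λ (γε g Λ ε) ∈ SET.localizedSectorsAt π U g (Λ₁, Λ₂) ∧
        SET.sectorInv π U g Λ (γε g Λ ε) ∈ SET.localizedSectorsAt π U g⁻¹ (Λ₁, Λ₂) ∧
        SET.IsIrreducibleRep (SET.sector π U g Λ (γε g Λ ε)) ∧
        SET.IsTensor π φ₀ (SET.sectorInv π U g Λ (γε g Λ ε)) (SET.sector π U g Λ (γε g Λ ε)) π) ∧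
    SET.anyonSubgroup π U φ₀ (Λ₁, Λ₂) = Set.univ := by

  have main : ∀ (Λ : SET.Cone) (ε : ℝ), Λ.IsLeft → Λ.Admissible ε →
      Λ.edge ε ⊆ (Λ₁ ∪ Λ₂)ᶜ → Λ₁ ⊆ Λ.region → Λ.region ⊆ Λ₂ᶜ →
      ∀ g : G,
        SET.sector π U g Λ (γε g Λ ε) ∈ SET.localizedSectorsAt π U g (Λ₁, Λ₂) ∧
        SET.sectorInv π U g Λ (γε g Λ ε) ∈ SET.localizedSectorsAt π U g⁻¹ (Λ₁, Λ₂) ∧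
        SET.IsIrreducibleRep (SET.sector π U g Λ (γε g Λ ε)) ∧
        SET.IsTensor π φ₀ (SET.sectorInv π U g Λ (γε g Λ ε)) (SET.sector π U g Λ (γε g Λ ε)) π :=
    fun Λ ε hl hε hedge h₁ h₂ g =>
      ⟨SET.sector_mem_localizedSectorsAt hexc hGNS hl hε hedge h₁ h₂ g,
        SET.sectorInv_mem_localizedSectorsAt hexc hGNS hl hε hedge h₁ h₂ g,
        SET.isIrreducibleRep_sector hexc hGNS hω hε g,
        SET.isTensor_sectorInv_sector hexc hGNS hφ₀' hε g⟩
  refine ⟨main, Set.eq_univ_of_forall fun g => ?_⟩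
  obtain ⟨Λ, ε, hl, hε, hedge, h₁, h₂⟩ := SET.exists_separating_leftCone hPC
  obtain ⟨hσ, hσ', hirr, htensor⟩ := main Λ ε hl hε hedge h₁ h₂ g
  exact ⟨_, hσ, _, hσ', hirr, htensor⟩
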